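/- Let $(X,d)$ be a connected metric space with at least two points and $(Y,d_Y)$ a separable metric space, equipped with Borel regular outer measures $\mu$ and $\nu$, respectively, for which every ball has finite measure. Balls $B(x,r)$, $0<r<\infty$, are open. Let $\Omega\subset X$ be nonempty, open and bounded, and let $f\colon\Omega\to f(\Omega)\subset Y$ be a homeomorphism with $f(\Omega)$ open and $\nu(f(\Omega))<\infty$. A curve is a rectifiable curve parametrized by arc length, $\gamma\colon[0,\ell_\gamma]\to X$; we write $\gamma$ also for its image, and $\int_\gamma\rho\,ds:=\int_0^{\ell_\gamma}\rho(\gamma(s))\,ds$. For a family $\Gamma$ of curves and $1\le p<\infty$, let $\mathrm{Mod}_p(\Gamma):=\inf\int_X\rho^p\,d\mu$, the infimum being over all Borel functions $\rho\colon X\to[0,\infty]$ with $\int_\gamma\rho\,ds\ge1$ for every $\gamma\in\Gamma$. A property holds for $p$-a.e. curve in $\Omega$ if the family of curves in $\Omega$ for which it fails has zero $p$-modulus. $\mathcal H^1$ denotes the $1$-dimensional Hausdorff measure. For $x\in\Omega$ and $r>0$ let $$L_f(x,r):=\sup\{d_Y(f(y),f(x)) : y\in\Omega,\ d(y,x)\le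 r\},\qquad l_f(x,r):=\inf\{d_Y(f(y),f(x)) : y\in\Omega,\ d(y,x)\ge r\},$$ $$H_f(x,r):=\frac{L_f(x,r)}{l_f(x,r)}\ \ (\text{interpreted as }\infty\text{ if } l_f(x,r)=0),\qquad h_f(x):=\liminf_{r\to0}H_f(x,r).$$ **Proposition 5.2.** Suppose there exists a Borel regular outer measure $\widetilde\mu\ge\mu$ on $X$ which is doubling within a ball $B(x_0,2r_0)$ with $\Omega\subset B(x_0,r_0)$; that is, there is a constant $C_d\ge1$ such that $0<\widetilde\mu(B(x,2r))\le C_d\,\widetilde\mu(B(x,r))<\infty$ for every ball $B(x,r)\subset B(x_0,2r_0)$. Suppose there exist a set $E\subset\Omega$ and a function $Q(\cdot)\colon\Omega\setminus E\to(1,\infty)$ such that $$\limsup_{r\to0}\frac{\widetilde\mu(B(x,r))}{r^{Q(x)}}<\infty\quad\text{and}\quad\liminf_{r\to0}\frac{\nu(B(f(x),r))}{r^{Q(x)}}>0\qquad\text{for all }x\in\Omega\setminus E.$$ Suppose that $Q:=\inf_{x\in\Omega\setminus E}Q(x)>1$ (with $\inf\emptyset=\infty$) and let $1\le p\le Q$,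 $p<\infty$. Suppose also that $$\mathrm{Mod}_p\big(\{\gamma\subset\Omega : \mathcal H^1(f(\gamma\cap E))>0\}\big)=0$$ and that $h_f<\infty$ in $\Omega\setminus E$. Then $f$ satisfies the $N$-property on $p$-a.e. curve $\gamma$ in $\Omega$; that is, for $p$-a.e. curve $\gamma$ in $\Omega$ we have $\mathcal H^1(f(\gamma(N)))=0$ for every $N\subset[0,\ell_\gamma]$ with $\mathcal L^1(N)=0$. -/

import Mathlib

open Set Filter Topology MeasureTheory
open scoped ENNReal NNReal

noncomputable section

namespace MetricQC

/-- A rectifiable curve in `X`, parametrized by arc length on `[0, len]`.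
Only the values of `toFun` on `[0, len]` are part of the curve; every notion below depends on
these values only. Unit speed means that the restriction to each `[s, t] ⊆ [0, len]` has
length `t - s`; in particular the curve is `1`-Lipschitz, hence continuous. Constant curves
(`len = 0`) are allowed. -/
structure Curve (X : Type*) [MetricSpace X] where
  len : ℝ
  len_nonneg : 0 ≤ len
  toFun : ℝ → X
  unitSpeed : HasUnitSpeedOn toFun (Icc 0 len)

/-- The image `γ([0, ℓ_γ])`. -/
def Curve.image {X : Type*} [MetricSpace X] (γ : Curve X) : Set X :=
  γ.toFun '' Icc 0 γ.len

/-- The line integral `∫_γ g ds = ∫_0^{ℓ_γ} g(γ(s)) ds`. -/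
def Curve.lineIntegral {X : Type*} [MetricSpace X] (γ : Curve X) (g : X → ℝ≥0∞) : ℝ≥0∞ :=
  ∫⁻ s in Icc 0 γ.len, g (γ.toFun s)

/-- The `p`-modulus of a family of curves: the infimum of `∫ ρ^p dμ` over all Borel
`ρ : X → [0, ∞]` with `∫_γ ρ ds ≥ 1` for every curve of the family (`∞` if there is none). -/
def modulus {X : Type*} [MetricSpace X] [MeasurableSpace X] (μ : Measure X) (p : ℝ)
    (Γ : Set (Curve X)) : ℝ≥0∞ :=
  ⨅ (ρ : X → ℝ≥0∞) (_ : Measurable ρ) (_ : ∀ γ ∈ Γ, 1 ≤ γ.lineIntegral ρ), ∫⁻ x, ρ x ^ p ∂μ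

/-- The property `P` holds for `p`-a.e. curve in `Ω`. -/
def AECurveIn {X : Type*} [MetricSpace X] [MeasurableSpace X] (μ : Measure X) (p : ℝ)
    (Ω : Set X) (P : Curve X → Prop) : Prop :=
  modulus μ p {γ | γ.image ⊆ Ω ∧ ¬ P γ} = 0

/-- `μ` is doubling within `W`: for some `C ≥ 1`, `0 < μ(B(x,2r)) ≤ C μ(B(x,r)) < ∞` for every
ball `B(x,r) ⊆ W`. -/
def DoublingWithin {X : Type*} [MetricSpace X] [MeasurableSpace X] (μ : Measure X)
    (W : Set X) : Prop :=
  ∃ C : ℝ≥0, 1 ≤ C ∧ ∀ (x : X) (r : ℝ), 0 < r → Metric.ball x r ⊆ W →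
    0 < μ (Metric.ball x (2 * r)) ∧
    μ (Metric.ball x (2 * r)) ≤ C * μ (Metric.ball x r) ∧
    C * μ (Metric.ball x r) < ∞

/-- `L_f(x,r) = sup {d(f(y),f(x)) : y ∈ Ω, d(y,x) ≤ r}` for a map `f` on `Ω`. -/
def Lsup {X Y : Type*} [MetricSpace X] [MetricSpace Y] (Ω : Set X) (f : X → Y)
    (x : X) (r : ℝ) : ℝ≥0∞ :=
  ⨆ y ∈ {y ∈ Ω | dist y x ≤ r}, edist (f y) (f x)

/-- `l_f(x,r) = inf {d(f(y),f(x)) : y ∈ Ω, d(y,x) ≥ r}` for a map `f` on `Ω`. -/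
def linf {X Y : Type*} [MetricSpace X] [MetricSpace Y] (Ω : Set X) (f : X → Y)
    (x : X) (r : ℝ) : ℝ≥0∞ :=
  ⨅ y ∈ {y ∈ Ω | r ≤ dist y x}, edist (f y) (f x)

open Classical in
/-- `H_f(x,r) = L_f(x,r) / l_f(x,r)`, interpreted as `∞` if the denominator is zero. -/
def distortionAt {X Y : Type*} [MetricSpace X] [MetricSpace Y] (Ω : Set X) (f : X → Y)
    (x : X) (r : ℝ) : ℝ≥0∞ :=
  if linf Ω f x r = 0 then ∞ else Lsup Ω f x r / linf Ω f x r

/-- `h_f(x) = liminf_{r → 0} H_f(x,r)`. -/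
def distortion {X Y : Type*} [MetricSpace X] [MetricSpace Y] (Ω : Set X) (f : X → Y)
    (x : X) : ℝ≥0∞ :=
  liminf (fun r : ℝ => distortionAt Ω f x r) (𝓝[>] 0)

/-- The `N_A`-property of `f` on `γ`: `H¹(f(γ(N) ∩ A)) = 0` for every Lebesgue null set
`N ⊆ [0, ℓ_γ]`. -/
def LusinNOn {X Y : Type*} [MetricSpace X] [MetricSpace Y] [MeasurableSpace Y] [BorelSpace Y]
    (A : Set X) (f : X → Y) (γ : Curve X) : Prop :=
  ∀ N : Set ℝ, N ⊆ Icc 0 γ.len → volume N = 0 →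
    Measure.hausdorffMeasure 1 (f '' (γ.toFun '' N ∩ A)) = 0

/-- The `N`-property of `f` on `γ`. -/
def LusinN {X Y : Type*} [MetricSpace X] [MetricSpace Y] [MeasurableSpace Y] [BorelSpace Y]
    (f : X → Y) (γ : Curve X) : Prop :=
  LusinNOn univ f γ

end MetricQC

end

/-!
For `x ∈ Ω \ E` and a small radius `r` with `H_f(x, r) ≤ M`, the image `f(B(x, r))` contains the
ball of radius `L_f(x, r) / (2M)` around `f x`, so the two density hypotheses give
`(L_f(x, r) / r) ^ Q(x) * μt(B(x, r)) ≤ C * ν(f(B(x, r)))`. Write `Ω \ E` as a countable union of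
sets `A` on which all constants are uniform (`controlledSet`, `exists_mem_controlledSet`). Given a
scale `δ`, choose good radii `r x < δ` on `A` and select greedily, in order of decreasing dyadic
size of the radius, centres `x_j` whose balls cover `A` (`exists_subset_ball_cover`). Although the
good radii form only a sequence tending to `0`, so that no ball may be enlarged, the order of
selection makes the balls `B(x_j, r_j / 4)` disjoint and the image balls of radius
`L_f(x_j, r_j) / (2M)` boundedly overlapping (`sum_measure_ball_image_le`). The function
`g = ∑ (L_f(x_j, r_j) / r_j) 1_{B(x_j, 2 r_j)}` then has `∫ g ^ q dμt` bounded independently of `δ`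
for `q = inf Q > 1`, by an inequality of Bojarski type
(`lintegral_tsum_indicator_closedBall_rpow_le`), and it controls the size `δ` Hausdorff content of
`f(γ ∩ A)` by `2 ∫_γ g ds` (`isUpperGradientAtScale_tsum_indicator`).

As `δ → 0`, convexity of `t ↦ t ^ q` provides, in place of weak compactness and Mazur's lemma, a
single function `G` with `∫ G ^ q < ∞` dominating admissible functions at all scales
(`exists_dominating_of_midpoint_convex`). Hence `H¹(f(γ(J) ∩ A)) ≤ 2 ∫_J G(γ(s)) ds` for all
intervals `J`. If `∫_γ G ds < ∞`, covering a null set by an open set on which the integral of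
`G ∘ γ` is small gives `H¹(f(γ(N) ∩ A)) = 0` (`lusinNOn_of_isUpperGradientAtScale`). The curves in
`Ω` with `∫_γ G ds = ∞` have zero `p`-modulus since `p ≤ q` and `μ(Ω) < ∞`, and the points of `E`
are taken care of by the hypothesis on `E`.
-/

noncomputable section

namespace MetricQC

/-! ### Sums of multiples of indicators of balls -/

theorem le_rpow_of_le_mul_rpow {q s : ℝ} (hqs : q.HolderConjugate s) {I c : ℝ≥0∞} (hI : I ≠ ∞)
    (h : I ≤ c * I ^ (1 / s)) : I ≤ c ^ q := by
  rcases eq_or_ne I 0 with rfl | h0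
  · exact zero_le
  have hs : I ^ (1 / s) ≠ 0 := by simp [ENNReal.rpow_eq_zero_iff, h0, hI]
  have hs' : I ^ (1 / s) ≠ ∞ := ENNReal.rpow_ne_top_of_nonneg (by simpa using hqs.symm.nonneg) hI
  have key : I ^ (1 / q) * I ^ (1 / s) ≤ c * I ^ (1 / s) := by
    rw [← ENNReal.rpow_add _ _ h0 hI]
    have := hqs.inv_add_inv_eq_one
    rw [one_div, one_div, this, ENNReal.rpow_one]
    simpa using h
  have h2 : I ^ (1 / q) ≤ c := (ENNReal.mul_le_mul_iff_left hs hs').1 key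
  calc I = (I ^ (1 / q)) ^ q := by
        rw [← ENNReal.rpow_mul, one_div, inv_mul_cancel₀ hqs.ne_zero, ENNReal.rpow_one]
    _ ≤ c ^ q := ENNReal.rpow_le_rpow h2 hqs.nonneg

/-- Doob's inequality: if `t * μ {M > t}` is bounded by `K` times the integral of `g` over the same
set `{M > t}`, then `‖M‖_s ≤ q K ‖g‖_s`. Both layer cake formulas, for `M ^ s` with respect to `μ`
and for `M ^ (s - 1)` with respect to `g μ`, involve the weight `t ^ (s - 2)` after inserting the
hypothesis, and Hölder's inequality closes the estimate. The a priori finiteness `hfin` permits to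
absorb the power of `∫ M ^ s` on the right. -/
theorem lintegral_ofReal_rpow_le_of_weak_type {X : Type*} [MeasurableSpace X] {μ : Measure X}
    {q s : ℝ} (hqs : q.HolderConjugate s) {M : X → ℝ} (hM0 : ∀ x, 0 ≤ M x) (hM : Measurable M)
    {g : X → ℝ≥0∞} (hg : Measurable g) {K : ℝ≥0}
    (hfin : ∫⁻ x, ENNReal.ofReal (M x ^ s) ∂μ ≠ ∞)
    (hweak : ∀ t : ℝ, 0 < t →
      ENNReal.ofReal t * μ {x | t < M x} ≤ K * μ.withDensity g {x | t < M x}) :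
    ∫⁻ x, ENNReal.ofReal (M x ^ s) ∂μ ≤ (ENNReal.ofReal q * K) ^ s * ∫⁻ x, g x ^ s ∂μ := by
  have hs1 : 0 < s - 1 := sub_pos.2 hqs.symm.lt
  have h1 := lintegral_rpow_eq_lintegral_meas_lt_mul μ (Eventually.of_forall hM0)
    hM.aemeasurable hqs.symm.pos
  have h2 := lintegral_rpow_eq_lintegral_meas_lt_mul (μ.withDensity g) (Eventually.of_forall hM0)
    hM.aemeasurable hs1
  have hmono : ∫⁻ t in Ioi (0 : ℝ), μ {x | t < M x} * ENNReal.ofReal (t ^ (s - 1)) ≤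
      K * ∫⁻ t in Ioi (0 : ℝ),
        μ.withDensity g {x | t < M x} * ENNReal.ofReal (t ^ (s - 1 - 1)) := by
    rw [← lintegral_const_mul' _ _ ENNReal.coe_ne_top]
    refine setLIntegral_mono' measurableSet_Ioi fun t ht => ?_
    have ht : 0 < t := ht
    have : t ^ (s - 1) = t * t ^ (s - 1 - 1) := by
      nth_rewrite 2 [← Real.rpow_one t]
      rw [← Real.rpow_add ht]; ring_nf
    rw [this, ENNReal.ofReal_mul ht.le, ← mul_assoc, ← mul_assoc, mul_comm (μ _)]
    exact mul_le_mul_left (hweak t ht) _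
  have hqeq : ENNReal.ofReal s = ENNReal.ofReal q * ENNReal.ofReal (s - 1) := by
    rw [← ENNReal.ofReal_mul hqs.nonneg]
    congr 1
    have := hqs.symm.conjugate_eq
    rw [this]; field_simp
  have h3 : ∫⁻ x, ENNReal.ofReal (M x ^ s) ∂μ ≤
      ENNReal.ofReal q * K * ∫⁻ x, (g * fun x => ENNReal.ofReal (M x ^ (s - 1))) x ∂μ := by
    have h4 := lintegral_withDensity_eq_lintegral_mul μ hg
      (f := g) (g := fun x => ENNReal.ofReal (M x ^ (s - 1))) (by fun_prop)
    rw [← h4, h2, h1, hqeq]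
    refine (mul_le_mul_right hmono _).trans_eq ?_
    simp only [mul_assoc, mul_left_comm]
  have h5 := ENNReal.lintegral_mul_le_Lp_mul_Lq μ hqs.symm hg.aemeasurable
    (g := fun x => ENNReal.ofReal (M x ^ (s - 1))) (by fun_prop)
  have h6 : ∀ x, ENNReal.ofReal (M x ^ (s - 1)) ^ q = ENNReal.ofReal (M x ^ s) := fun x => by
    rw [ENNReal.ofReal_rpow_of_nonneg (Real.rpow_nonneg (hM0 x) _) hqs.nonneg,
      ← Real.rpow_mul (hM0 x), hqs.symm.sub_one_mul_conj]
  simp only [h6] at h5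
  have h7 := le_rpow_of_le_mul_rpow hqs.symm hfin
    (c := ENNReal.ofReal q * K * (∫⁻ x, g x ^ s ∂μ) ^ (1 / s))
    (h3.trans (by rw [mul_assoc (ENNReal.ofReal q * K)]; exact mul_le_mul_right h5 _))
  refine h7.trans_eq ?_
  rw [ENNReal.mul_rpow_of_nonneg _ _ hqs.symm.nonneg, ← ENNReal.rpow_mul, one_div,
    inv_mul_cancel₀ hqs.symm.ne_zero, ENNReal.rpow_one]



/-- The `L^q` norm of `∑ a_i 1_{B(x_i, 2 r_i)}` is controlled as if the balls were the disjoint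
cores `B(x_i, r_i / 4)`. With `ρ` the sum, `∫ ρ ^ q = ∑ a_i ∫_{B(x_i, 2 r_i)} ρ ^ (q - 1)`, which is at
most `K ∑ a_i b_i μ(B(x_i, r_i / 4))` for the averages `b_i` of `ρ ^ (q - 1)`; the latter are
controlled by the maximal function over the finitely many balls at hand, which is of strong type
by the Vitali covering lemma and `lintegral_ofReal_rpow_le_of_weak_type`. -/
theorem lintegral_sum_indicator_closedBall_rpow_le {X : Type*} [PseudoMetricSpace X]
    [MeasurableSpace X] [BorelSpace X] {μ : Measure X} {ι : Type*} (s : Finset ι)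
    {x : ι → X} {r : ι → ℝ} {K : ℝ≥0} (hr : ∀ i ∈ s, 0 < r i)
    (hK : ∀ i ∈ s, μ (Metric.closedBall (x i) (8 * r i)) ≤ K * μ (Metric.ball (x i) (r i / 4)))
    (hpos : ∀ i ∈ s, μ (Metric.ball (x i) (r i / 4)) ≠ 0)
    (hfin : ∀ i ∈ s, μ (Metric.ball (x i) (r i / 4)) ≠ ∞)
    (hdisj : (s : Set ι).PairwiseDisjoint fun i => Metric.ball (x i) (r i / 4))
    {a : ι → ℝ≥0∞} (ha : ∀ i ∈ s, a i ≠ ∞) {q : ℝ} (hq : 1 < q) :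
    ∫⁻ z, (∑ i ∈ s, (Metric.closedBall (x i) (2 * r i)).indicator (fun _ => a i) z) ^ q ∂μ ≤
      (ENNReal.ofReal q * K ^ 2) ^ q * ∑ i ∈ s, a i ^ q * μ (Metric.ball (x i) (r i / 4)) := by
  classical
  obtain ⟨t, hqt⟩ : ∃ t, q.HolderConjugate t := ⟨_, Real.HolderConjugate.conjExponent hq⟩
  have hq1 : 0 < q - 1 := sub_pos.2 hq
  set V : ι → Set X := fun i => Metric.closedBall (x i) (2 * r i) with hV
  set D : ι → Set X := fun i => Metric.ball (x i) (r i / 4) with hD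
  have hVm : ∀ i, MeasurableSet (V i) := fun i => Metric.isClosed_closedBall.measurableSet
  have hDm : ∀ i, MeasurableSet (D i) := fun i => Metric.isOpen_ball.measurableSet
  have hDV : ∀ i ∈ s, D i ⊆ V i := fun i hi => Metric.ball_subset_closedBall.trans
    (Metric.closedBall_subset_closedBall (by linarith [hr i hi]))
  have hVW : ∀ i ∈ s, V i ⊆ Metric.closedBall (x i) (8 * r i) := fun i hi =>
    Metric.closedBall_subset_closedBall (by linarith [hr i hi])
  have hVK : ∀ i ∈ s, μ (V i) ≤ K * μ (D i) := fun i hi => (measure_mono (hVW i hi)).trans (hK i hi)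
  have hVfin : ∀ i ∈ s, μ (V i) ≠ ∞ := fun i hi =>
    ((hVK i hi).trans_lt (ENNReal.mul_lt_top ENNReal.coe_lt_top (hfin i hi).lt_top)).ne
  have hVpos : ∀ i ∈ s, μ (V i) ≠ 0 := fun i hi h => hpos i hi (measure_mono_null (hDV i hi) h)
  set ρ : X → ℝ≥0∞ := fun z => ∑ i ∈ s, (V i).indicator (fun _ => a i) z with hρ
  have hρm : Measurable ρ := by
    refine Finset.measurable_fun_sum _ fun i _ => measurable_const.indicator (hVm i)
  have hρle : ∀ z, ρ z ≤ ∑ i ∈ s, a i := fun z =>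
    Finset.sum_le_sum fun i _ => indicator_le_self _ _ _
  have hsum : ∑ i ∈ s, a i ≠ ∞ := ENNReal.sum_ne_top.2 ha
  set g : X → ℝ≥0∞ := fun z => ρ z ^ (q - 1) with hg
  have hgm : Measurable g := hρm.pow_const _
  have hgV : ∀ i ∈ s, ∫⁻ z in V i, g z ∂μ ≠ ∞ := fun i hi => by
    refine ((setLIntegral_mono measurable_const
      fun z _ => ENNReal.rpow_le_rpow (hρle z) hq1.le).trans_lt ?_).ne
    rw [setLIntegral_const]
    exact ENNReal.mul_lt_top (ENNReal.rpow_ne_top_of_nonneg hq1.le hsum).lt_top (hVfin i hi).lt_top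
  have hI : ∫⁻ z, ρ z ^ q ∂μ = ∑ i ∈ s, a i * ∫⁻ z in V i, g z ∂μ := by
    have : ∀ z, ρ z ^ q = ∑ i ∈ s, (V i).indicator (fun z => a i * g z) z := fun z => by
      have h1 : ρ z ^ q = ρ z * g z := by
        rcases eq_or_ne (ρ z) 0 with h0 | h0
        · simp [h0, hqt.pos]
        · have h2 : ρ z ≠ ∞ := ((hρle z).trans_lt hsum.lt_top).ne
          nth_rewrite 2 [← ENNReal.rpow_one (ρ z)]
          rw [hg, ← ENNReal.rpow_add _ _ h0 h2]
          ring_nf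
      rw [h1, hρ, Finset.sum_mul]
      refine Finset.sum_congr rfl fun i _ => ?_
      by_cases hz : z ∈ V i <;> simp [hz]
    simp_rw [this]
    rw [lintegral_finsetSum _ fun i _ => (hgm.const_mul _).indicator (hVm i)]
    refine Finset.sum_congr rfl fun i _ => ?_
    rw [lintegral_indicator (hVm i), lintegral_const_mul _ hgm]
  have hIfin : ∫⁻ z, ρ z ^ q ∂μ ≠ ∞ := by
    rw [hI]
    exact ENNReal.sum_ne_top.2 fun i hi => ENNReal.mul_ne_top (ha i hi) (hgV i hi)
  -- the averages of `g` over the balls, and their maximal function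
  set b : ι → ℝ≥0∞ := fun i => (∫⁻ z in V i, g z ∂μ) / μ (V i) with hb
  have hbV : ∀ i ∈ s, b i * μ (V i) = ∫⁻ z in V i, g z ∂μ := fun i hi =>
    ENNReal.div_mul_cancel (hVpos i hi) (hVfin i hi)
  have hbfin : ∀ i ∈ s, b i ≠ ∞ := fun i hi => ENNReal.div_ne_top (hgV i hi) (hVpos i hi)
  set S : X → ℝ≥0∞ := fun z => s.sup fun i => (V i).indicator (fun _ => b i) z with hS
  have hSm : Measurable S := by
    simp only [hS, Finset.sup_eq_iSup]
    exact Measurable.biSup (s : Set ι) s.countable_toSet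
      fun i _ => measurable_const.indicator (hVm i)
  have hSle : ∀ z, S z ≤ ∑ i ∈ s, (V i).indicator (fun _ => b i) z := fun z =>
    Finset.sup_le fun i hi =>
      Finset.single_le_sum (f := fun i => (V i).indicator (fun _ => b i) z)
        (fun _ _ => zero_le) hi
  have hSfin : ∀ z, S z ≠ ∞ := fun z =>
    ((hSle z).trans_lt (ENNReal.sum_lt_top.2 fun i hi =>
      (indicator_le_self _ _ _).trans_lt (hbfin i hi).lt_top)).ne
  have hofReal : ∀ z, ENNReal.ofReal ((S z).toReal ^ t) = S z ^ t := fun z => by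
    rw [← ENNReal.ofReal_rpow_of_nonneg ENNReal.toReal_nonneg hqt.symm.nonneg,
      ENNReal.ofReal_toReal (hSfin z)]
  have hSpow : ∀ z, S z ^ t ≤ ∑ i ∈ s, (V i).indicator (fun _ => b i ^ t) z := fun z => by
    by_cases hz : ∃ i ∈ s, z ∈ V i
    · obtain ⟨j, hj, -⟩ := hz
      obtain ⟨i, hi, hiS⟩ := Finset.exists_mem_eq_sup s ⟨j, hj⟩
        fun i => (V i).indicator (fun _ => b i) z
      have h1 : S z ^ t = (V i).indicator (fun _ => b i ^ t) z := by
        simp only [hS, hiS]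
        by_cases hz : z ∈ V i <;> simp [hz, hqt.symm.pos]
      rw [h1]
      exact Finset.single_le_sum (f := fun i => (V i).indicator (fun _ => b i ^ t) z)
        (fun _ _ => zero_le) hi
    · push Not at hz
      have h0 : S z = 0 := le_antisymm
        (Finset.sup_le fun i hi => by simp [hz i hi]) zero_le
      simp [h0, hqt.symm.pos]
  have hSint : ∫⁻ z, ENNReal.ofReal ((S z).toReal ^ t) ∂μ ≠ ∞ := by
    simp only [hofReal]
    refine ((lintegral_mono hSpow).trans_lt ?_).ne
    rw [lintegral_finsetSum _ fun i _ => measurable_const.indicator (hVm i)]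
    refine ENNReal.sum_lt_top.2 fun i hi => ?_
    rw [lintegral_indicator_const (hVm i)]
    exact ENNReal.mul_lt_top
      (ENNReal.rpow_ne_top_of_nonneg hqt.symm.nonneg (hbfin i hi)).lt_top (hVfin i hi).lt_top
  have hlt : ∀ (τ : ℝ), 0 < τ → ∀ z, τ < (S z).toReal ↔
      ∃ i ∈ s, ENNReal.ofReal τ < b i ∧ z ∈ V i := fun τ hτ z => by
    rw [← ENNReal.ofReal_lt_iff_lt_toReal hτ.le (hSfin z), hS, Finset.lt_sup_iff]
    refine exists_congr fun i => and_congr_right fun hi => ?_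
    by_cases hz : z ∈ V i <;> simp [hz]
  -- weak type estimate, by the Vitali covering lemma applied to the balls of average above `τ`
  have hweak : ∀ τ : ℝ, 0 < τ → ENNReal.ofReal τ * μ {z | τ < (S z).toReal} ≤
      K * μ.withDensity g {z | τ < (S z).toReal} := fun τ hτ => by
    obtain ⟨u, huJ, hudisj, hucov⟩ :=
      Vitali.exists_disjoint_subfamily_covering_enlargement_closedBall
      {i | i ∈ s ∧ ENNReal.ofReal τ < b i} x (fun i => 2 * r i) (∑ i ∈ s, 2 * r i)
      (fun i hi => Finset.single_le_sum (f := fun i => 2 * r i)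
        (fun j hj => by linarith [hr j hj]) hi.1) 4 (by norm_num)
    have hus : ∀ i ∈ u, i ∈ s := fun i hi => (huJ hi).1
    have hufin : u.Finite := s.finite_toSet.subset hus
    have hsub : {z | τ < (S z).toReal} ⊆ ⋃ i ∈ u, Metric.closedBall (x i) (8 * r i) := by
      intro z hz
      obtain ⟨i, hi, hib, hzi⟩ := (hlt τ hτ z).1 hz
      obtain ⟨j, hj, hij⟩ := hucov i ⟨hi, hib⟩
      have := hij hzi
      rw [← mul_assoc] at this
      norm_num at this
      exact mem_biUnion hj (Metric.mem_closedBall.2 this)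
    have hsup : (⋃ i ∈ u, V i) ⊆ {z | τ < (S z).toReal} := fun z hz => by
      obtain ⟨i, hi, hzi⟩ := mem_iUnion₂.1 hz
      exact (hlt τ hτ z).2 ⟨i, hus i hi, (huJ hi).2, hzi⟩
    calc ENNReal.ofReal τ * μ {z | τ < (S z).toReal}
        ≤ ENNReal.ofReal τ * ∑' i : u, μ (Metric.closedBall (x i) (8 * r i)) := by
          gcongr
          exact (measure_mono hsub).trans (measure_biUnion_le μ hufin.countable _)
      _ = ∑' i : u, ENNReal.ofReal τ * μ (Metric.closedBall (x i) (8 * r i)) :=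
          ENNReal.tsum_mul_left.symm
      _ ≤ ∑' i : u, K * μ.withDensity g (V i) := by
          refine ENNReal.tsum_le_tsum fun i => ?_
          have hi := hus i i.2
          rw [withDensity_apply _ (hVm i), ← hbV i hi]
          calc _ ≤ b i * (K * μ (V i)) := by
                gcongr
                · exact (huJ i.2).2.le
                · exact (hK i hi).trans (by gcongr; exact hDV i hi)
            _ = _ := by ring
      _ = K * μ.withDensity g (⋃ i ∈ u, V i) := by
          rw [ENNReal.tsum_mul_left, measure_biUnion hufin.countable hudisj fun i _ => hVm i]
      _ ≤ _ := by gcongr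
  have hmax := lintegral_ofReal_rpow_le_of_weak_type hqt (fun z => ENNReal.toReal_nonneg)
    hSm.ennreal_toReal hgm hSint hweak
  have hgt : ∀ z, g z ^ t = ρ z ^ q := fun z => by
    rw [hg, ← ENNReal.rpow_mul, hqt.sub_one_mul_conj]
  simp only [hofReal, hgt] at hmax
  -- the averages are dominated by the maximal function on the disjoint cores
  have hcore : ∑ i ∈ s, b i ^ t * μ (D i) ≤ ∫⁻ z, S z ^ t ∂μ := by
    calc ∑ i ∈ s, b i ^ t * μ (D i) ≤ ∑ i ∈ s, ∫⁻ z in D i, S z ^ t ∂μ := by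
          refine Finset.sum_le_sum fun i hi => ?_
          rw [← setLIntegral_const]
          refine setLIntegral_mono' (hDm i) fun z hz => ENNReal.rpow_le_rpow ?_ hqt.symm.nonneg
          refine le_trans ?_ (Finset.le_sup (f := fun i => (V i).indicator (fun _ => b i) z) hi)
          simp [hDV i hi hz]
      _ = ∫⁻ z in ⋃ i ∈ s, D i, S z ^ t ∂μ :=
          (lintegral_biUnion_finset hdisj (fun i _ => hDm i) _).symm
      _ ≤ _ := setLIntegral_le_lintegral _ _
  set A := ∑ i ∈ s, a i ^ q * μ (D i) with hA
  have hholder : ∑ i ∈ s, a i * b i * μ (D i) ≤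
      A ^ (1 / q) * (∑ i ∈ s, b i ^ t * μ (D i)) ^ (1 / t) := by
    have h := ENNReal.inner_le_Lp_mul_Lq s (fun i => a i * μ (D i) ^ (1 / q))
      (fun i => b i * μ (D i) ^ (1 / t)) hqt
    simp only [ENNReal.mul_rpow_of_nonneg _ _ hqt.nonneg,
      ENNReal.mul_rpow_of_nonneg _ _ hqt.symm.nonneg, ← ENNReal.rpow_mul, one_div,
      inv_mul_cancel₀ hqt.ne_zero, inv_mul_cancel₀ hqt.symm.ne_zero, ENNReal.rpow_one] at h
    simp only [one_div]
    refine le_trans (le_of_eq (Finset.sum_congr rfl fun i hi => ?_)) h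
    have : μ (D i) = μ (D i) ^ q⁻¹ * μ (D i) ^ t⁻¹ := by
      rw [← ENNReal.rpow_add _ _ (hpos i hi) (hfin i hi), hqt.inv_add_inv_eq_one, ENNReal.rpow_one]
    nth_rewrite 1 [this]
    ring
  have hfinal : ∫⁻ z, ρ z ^ q ∂μ ≤
      (ENNReal.ofReal q * K ^ 2 * A ^ (1 / q)) * (∫⁻ z, ρ z ^ q ∂μ) ^ (1 / t) := by
    calc ∫⁻ z, ρ z ^ q ∂μ = ∑ i ∈ s, a i * ∫⁻ z in V i, g z ∂μ := hI
      _ ≤ ∑ i ∈ s, K * (a i * b i * μ (D i)) := by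
          refine Finset.sum_le_sum fun i hi => ?_
          rw [← hbV i hi]
          calc _ ≤ a i * (b i * (K * μ (D i))) := by gcongr; exact hVK i hi
            _ = _ := by ring
      _ = K * ∑ i ∈ s, a i * b i * μ (D i) := by rw [Finset.mul_sum]
      _ ≤ K * (A ^ (1 / q) *
            ((ENNReal.ofReal q * K) ^ t * ∫⁻ z, ρ z ^ q ∂μ) ^ (1 / t)) := by
          gcongr
          refine hholder.trans ?_
          gcongr
          · exact one_div_nonneg.2 hqt.symm.nonneg
          · exact hcore.trans hmax
      _ = _ := by
          rw [ENNReal.mul_rpow_of_nonneg _ _ (one_div_nonneg.2 hqt.symm.nonneg),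
            ← ENNReal.rpow_mul, mul_one_div_cancel hqt.symm.ne_zero, ENNReal.rpow_one]
          ring
  refine (le_rpow_of_le_mul_rpow hqt hIfin hfinal).trans_eq ?_
  rw [ENNReal.mul_rpow_of_nonneg _ _ hqt.nonneg, ← ENNReal.rpow_mul,
    one_div_mul_cancel hqt.ne_zero, ENNReal.rpow_one]

/-! ### Dominated selection from convex sets of functions -/

/-- A quantitative form of the strict convexity of `t ↦ t ^ q`: `|b - a| ^ q` is at most
`ε (a ^ q + b ^ q)` plus a multiple of the midpoint convexity defect
`(a ^ q + b ^ q) / 2 - ((a + b) / 2) ^ q`. Terms are arranged so that no subtraction is needed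
after passing to extended reals. -/
theorem exists_abs_sub_rpow_le {q : ℝ} (hq : 1 < q) {ε : ℝ} (hε : 0 < ε) :
    ∃ C : ℝ, 0 ≤ C ∧ ∀ a b : ℝ, 0 ≤ a → 0 ≤ b →
      |b - a| ^ q + C * ((a + b) / 2) ^ q ≤ (ε + C / 2) * (a ^ q + b ^ q) := by
  have hq0 : 0 < q := zero_lt_one.trans hq
  -- on the segment `a = t`, `b = 1 - t`: the defect `D` vanishes only at `t = 1 / 2`, where `F < 0`
  set D : ℝ → ℝ := fun t => (t ^ q + (1 - t) ^ q) / 2 - (1 / 2 : ℝ) ^ q with hD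
  set F : ℝ → ℝ := fun t => |1 - 2 * t| ^ q - ε * (t ^ q + (1 - t) ^ q) with hF
  have hDc : Continuous D := by
    have h1 : Continuous fun t : ℝ => t ^ q := Real.continuous_rpow_const hq0.le
    have h2 : Continuous fun t : ℝ => (1 - t) ^ q := h1.comp (by fun_prop)
    fun_prop
  have hFc : Continuous F := by
    have h1 : Continuous fun t : ℝ => t ^ q := Real.continuous_rpow_const hq0.le
    have h2 : Continuous fun t : ℝ => (1 - t) ^ q := h1.comp (by fun_prop)
    have h3 : Continuous fun t : ℝ => |1 - 2 * t| ^ q := h1.comp (by fun_prop)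
    fun_prop
  have hDpos : ∀ t ∈ Icc (0 : ℝ) 1, t ≠ 1 / 2 → 0 < D t := fun t ht hne => by
    have h1 : 1 - t ∈ Ici (0 : ℝ) := sub_nonneg.2 ht.2
    have h := (strictConvexOn_rpow hq).2 ht.1 h1 (fun h => hne (by linarith))
      (show (0 : ℝ) < 1 / 2 by norm_num) (show (0 : ℝ) < 1 / 2 by norm_num) (by norm_num)
    simp only [smul_eq_mul] at h
    have h2 : (1 / 2 : ℝ) * t + 1 / 2 * (1 - t) = 1 / 2 := by ring
    rw [h2] at h
    simp only [hD]; linarith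
  have hhalf : F (1 / 2) < 0 := by
    simp only [hF]
    norm_num [Real.zero_rpow hq0.ne']
    positivity
  have hD0 : ∀ t ∈ Icc (0 : ℝ) 1, 0 ≤ D t := fun t ht => by
    rcases eq_or_ne t (1 / 2) with rfl | h
    · simp only [hD]; norm_num
    · exact (hDpos t ht h).le
  have hF1 : ∀ t ∈ Icc (0 : ℝ) 1, F t ≤ 1 := fun t ht => by
    have h1 : |1 - 2 * t| ^ q ≤ 1 := Real.rpow_le_one (abs_nonneg _)
      (abs_le.2 ⟨by linarith [ht.2], by linarith [ht.1]⟩) hq0.le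
    have h2 : 0 ≤ t ^ q := Real.rpow_nonneg ht.1 _
    have h3 : 0 ≤ (1 - t) ^ q := Real.rpow_nonneg (sub_nonneg.2 ht.2) _
    simp only [hF]
    nlinarith [mul_nonneg hε.le (add_nonneg h2 h3)]
  obtain ⟨C, hC0, hC⟩ : ∃ C : ℝ, 0 ≤ C ∧ ∀ t ∈ Icc (0 : ℝ) 1, F t ≤ C * D t := by
    have hK : IsCompact (Icc (0 : ℝ) 1 ∩ {t | 0 ≤ F t}) :=
      isCompact_Icc.inter_right (isClosed_le continuous_const hFc)
    rcases (Icc (0 : ℝ) 1 ∩ {t | 0 ≤ F t}).eq_empty_or_nonempty with he | hne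
    · refine ⟨0, le_rfl, fun t ht => ?_⟩
      by_contra! h
      have : t ∈ Icc (0 : ℝ) 1 ∩ {t | 0 ≤ F t} := ⟨ht, by simpa using h.le⟩
      simp [he] at this
    · obtain ⟨t₀, ht₀, hmin⟩ := hK.exists_isMinOn hne hDc.continuousOn
      have hd : 0 < D t₀ := hDpos t₀ ht₀.1 (by rintro rfl; exact absurd ht₀.2 (not_le.2 hhalf))
      refine ⟨1 / D t₀, by positivity, fun t ht => ?_⟩
      by_cases h : 0 ≤ F t
      · have h1 : D t₀ ≤ D t := hmin ⟨ht, h⟩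
        calc F t ≤ 1 := hF1 t ht
          _ = 1 / D t₀ * D t₀ := by field_simp
          _ ≤ _ := by gcongr
      · exact (not_le.1 h).le.trans (mul_nonneg (by positivity) (hD0 t ht))
  refine ⟨C, hC0, fun a b ha hb => ?_⟩
  rcases eq_or_lt_of_le (add_nonneg ha hb) with h0 | hσ
  · have ha0 : a = 0 := by linarith
    have hb0 : b = 0 := by linarith
    simp [ha0, hb0, Real.zero_rpow hq0.ne']
  -- by homogeneity it suffices to treat `a + b = 1`
  set σ := a + b with hσd
  have h := hC (a / σ) ⟨by positivity, (div_le_one hσ).2 (by linarith)⟩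
  have e1 : 1 - a / σ = b / σ := by field_simp; linarith
  have e2 : 1 - 2 * (a / σ) = (b - a) / σ := by field_simp; linarith
  simp only [hF, hD, e1, e2, abs_div, abs_of_pos hσ] at h
  rw [Real.div_rpow (abs_nonneg _) hσ.le, Real.div_rpow ha hσ.le, Real.div_rpow hb hσ.le] at h
  rw [div_eq_mul_one_div σ 2, Real.mul_rpow hσ.le (by norm_num)]
  have hp : 0 < σ ^ q := Real.rpow_pos_of_pos hσ _
  have h' := mul_le_mul_of_nonneg_right h hp.le
  have f1 : (|b - a| ^ q / σ ^ q - ε * (a ^ q / σ ^ q + b ^ q / σ ^ q)) * σ ^ q =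
      |b - a| ^ q - ε * (a ^ q + b ^ q) := by field_simp
  have f2 : C * ((a ^ q / σ ^ q + b ^ q / σ ^ q) / 2 - (1 / 2) ^ q) * σ ^ q =
      C * ((a ^ q + b ^ q) / 2 - (1 / 2) ^ q * σ ^ q) := by field_simp
  rw [f1, f2] at h'
  linarith

theorem exists_sub_rpow_add_le {q : ℝ} (hq : 1 < q) {ε : ℝ≥0} (hε : ε ≠ 0) :
    ∃ C : ℝ≥0, ∀ a b : ℝ≥0∞, a ≠ ∞ → b ≠ ∞ →
      (b - a) ^ q + C * ((a + b) / 2) ^ q ≤ (ε + C / 2) * (a ^ q + b ^ q) := by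
  have hq0 : 0 < q := zero_lt_one.trans hq
  obtain ⟨C, hC0, hC⟩ := exists_abs_sub_rpow_le hq (ε := ε) (by positivity)
  lift C to ℝ≥0 using hC0
  refine ⟨C, fun a b ha hb => ?_⟩
  lift a to ℝ≥0 using ha
  lift b to ℝ≥0 using hb
  have h2 : (2 : ℝ≥0∞) = ((2 : ℝ≥0) : ℝ≥0∞) := rfl
  rw [h2, ← ENNReal.coe_add, ← ENNReal.coe_div two_ne_zero, ← ENNReal.coe_div two_ne_zero,
    ← ENNReal.coe_sub, ← ENNReal.coe_rpow_of_nonneg _ hq0.le, ← ENNReal.coe_rpow_of_nonneg _ hq0.le,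
    ← ENNReal.coe_rpow_of_nonneg _ hq0.le, ← ENNReal.coe_rpow_of_nonneg _ hq0.le]
  norm_cast
  have h := hC a b a.2 b.2
  rw [← NNReal.coe_le_coe]
  push_cast
  refine le_trans ?_ h
  gcongr
  rw [NNReal.coe_sub_def]
  exact max_le (le_abs_self _) (abs_nonneg _)

/-- A crude substitute for Minkowski's inequality: `∑ a k ≤ sup_k 2 ^ (k + 1) a k`. -/
theorem tsum_rpow_le_tsum_two_pow_mul_rpow {q : ℝ} (hq : 0 < q) (a : ℕ → ℝ≥0∞) :
    (∑' k, a k) ^ q ≤ ∑' k, (2 ^ (k + 1) * a k) ^ q := by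
  set T := ∑' k, (2 ^ (k + 1) * a k) ^ q
  have h1 : ∀ k, a k ≤ (2⁻¹) ^ (k + 1) * T ^ (1 / q) := fun k => by
    have h2 : 2 ^ (k + 1) * a k ≤ T ^ (1 / q) := by
      rw [one_div, ENNReal.le_rpow_inv_iff hq]
      exact ENNReal.le_tsum k
    calc a k = (2⁻¹) ^ (k + 1) * (2 ^ (k + 1) * a k) := by
          rw [← mul_assoc, ← mul_pow, ENNReal.inv_mul_cancel two_ne_zero ENNReal.ofNat_ne_top,
            one_pow, one_mul]
      _ ≤ _ := by gcongr
  have h3 : ∑' k, a k ≤ T ^ (1 / q) := by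
    refine (ENNReal.tsum_le_tsum h1).trans_eq ?_
    rw [ENNReal.tsum_mul_right]
    simp only [pow_succ]
    rw [ENNReal.tsum_mul_right, ENNReal.tsum_geometric_two, ENNReal.mul_inv_cancel two_ne_zero
      ENNReal.ofNat_ne_top, one_mul]
  rwa [one_div, ENNReal.le_rpow_inv_iff hq] at h3

/-- Let `C n` be a decreasing sequence of midpoint convex sets of measurable functions, each
containing a function with `∫ g ^ q ≤ B`. Then some `G` with `∫ G ^ q < ∞` dominates an element of
each `C n`. This replaces weak compactness and Mazur's lemma: functions of almost minimal norm in
`C n` form a Cauchy sequence by convexity, and `G` is the first of a fast converging sequence of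
these plus the sum of the (positive parts of the) increments. -/
theorem exists_dominating_of_midpoint_convex {X : Type*} [MeasurableSpace X] {μ : Measure X}
    {q : ℝ} (hq : 1 < q) {C : ℕ → Set (X → ℝ≥0∞)} (hmeas : ∀ n, ∀ g ∈ C n, Measurable g)
    (hanti : Antitone C)
    (hmid : ∀ n, ∀ g ∈ C n, ∀ h ∈ C n, (fun x => (g x + h x) / 2) ∈ C n) {B : ℝ≥0}
    (hB : ∀ n, ∃ g ∈ C n, ∫⁻ x, g x ^ q ∂μ ≤ B) :
    ∃ G : X → ℝ≥0∞, Measurable G ∧ ∫⁻ x, G x ^ q ∂μ ≠ ∞ ∧ ∀ n, ∃ h ∈ C n, ∀ x, h x ≤ G x := by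
  have hq0 : 0 < q := zero_lt_one.trans hq
  set I : ℕ → ℝ≥0∞ := fun n => ⨅ g ∈ C n, ∫⁻ x, g x ^ q ∂μ with hI
  have hImono : Monotone I := fun m n hmn => biInf_mono fun g hg => hanti hmn hg
  have hIB : ∀ n, I n ≤ B := fun n => by
    obtain ⟨g, hg, hgB⟩ := hB n
    exact (iInf₂_le g hg).trans hgB
  set J : ℝ≥0∞ := ⨆ n, I n with hJ
  have hJB : J ≤ B := iSup_le hIB
  have hJtop : J ≠ ∞ := (hJB.trans_lt ENNReal.coe_lt_top).ne
  -- almost minimisers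
  set S : ℕ → Set (X → ℝ≥0∞) := fun n =>
    {g | g ∈ C n ∧ ∫⁻ x, g x ^ q ∂μ ≤ J + ((n : ℝ≥0∞) + 1)⁻¹} with hS
  have hSanti : Antitone S := fun m n hmn g hg => by
    refine ⟨hanti hmn hg.1, hg.2.trans ?_⟩
    gcongr
  have hSne : ∀ n, (S n).Nonempty := fun n => by
    have h1 : I n < J + ((n : ℝ≥0∞) + 1)⁻¹ :=
      (le_iSup I n).trans_lt (ENNReal.lt_add_right hJtop (by simp))
    obtain ⟨g, hg⟩ := iInf_lt_iff.1 h1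
    obtain ⟨hgC, hg⟩ := iInf_lt_iff.1 hg
    exact ⟨g, hgC, hg.le⟩
  have hSfin : ∀ n, ∀ g ∈ S n, ∫⁻ x, g x ^ q ∂μ ≤ B + 1 := fun n g hg =>
    hg.2.trans (add_le_add hJB (by simp))
  -- two almost minimisers are close, since their midpoint is not better than the infimum
  have hcauchy : ∀ η : ℝ≥0, η ≠ 0 → ∃ N, ∀ g ∈ S N, ∀ h ∈ S N,
      ∫⁻ x, (h x - g x) ^ q ∂μ ≤ η := fun η hη => by
    set ε : ℝ≥0 := η / (4 * (B + 1)) with hε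
    have hε0 : ε ≠ 0 := by positivity
    obtain ⟨c, hc⟩ := exists_sub_rpow_add_le hq hε0
    have hlim : Tendsto (fun n => (c : ℝ≥0∞) * (I n)) atTop (𝓝 (c * J)) :=
      ENNReal.Tendsto.const_mul (tendsto_atTop_iSup hImono) (Or.inr ENNReal.coe_ne_top)
    have hcJ : (c : ℝ≥0∞) * J ≠ ∞ := ENNReal.mul_ne_top ENNReal.coe_ne_top hJtop
    have hη4 : (η / 4 : ℝ≥0∞) ≠ 0 := by simp [hη]
    have hev1 : ∀ᶠ n in atTop, (c : ℝ≥0∞) * J ≤ c * I n + η / 4 := by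
      have : ∀ᶠ n in atTop, (c : ℝ≥0∞) * J < c * I n + η / 4 :=
        (hlim.add tendsto_const_nhds).eventually_const_lt (ENNReal.lt_add_right hcJ hη4)
      exact this.mono fun _ => le_of_lt
    have hev2 : ∀ᶠ n : ℕ in atTop, (c : ℝ≥0∞) * ((n : ℝ≥0∞) + 1)⁻¹ ≤ η / 4 := by
      have h0 : Tendsto (fun n : ℕ => (c : ℝ≥0∞) * ((n : ℝ≥0∞) + 1)⁻¹) atTop (𝓝 (c * 0)) := by
        refine ENNReal.Tendsto.const_mul ?_ (Or.inr ENNReal.coe_ne_top)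
        have := (tendsto_add_atTop_iff_nat 1).2 ENNReal.tendsto_inv_nat_nhds_zero
        simpa using this
      rw [mul_zero] at h0
      exact (h0.eventually_lt_const (pos_iff_ne_zero.2 hη4)).mono fun _ => le_of_lt
    obtain ⟨N, hN1, hN2⟩ := (hev1.and hev2).exists
    refine ⟨N, fun g hg h hh => ?_⟩
    have hgm := hmeas N g hg.1
    have hhm := hmeas N h hh.1
    have hae : ∀ k ∈ S N, ∀ᵐ x ∂μ, k x ≠ ∞ := fun k hk => by
      have h1 := ae_lt_top ((hmeas N k hk.1).pow_const q)
        ((hSfin N k hk).trans_lt (by norm_num)).ne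
      filter_upwards [h1] with x hx hx'
      simp [hx', hq0] at hx
    have hint : ∫⁻ x, (h x - g x) ^ q ∂μ + c * ∫⁻ x, ((g x + h x) / 2) ^ q ∂μ ≤
        (ε + c / 2) * (∫⁻ x, g x ^ q ∂μ + ∫⁻ x, h x ^ q ∂μ) := by
      rw [← lintegral_const_mul _ (by fun_prop), ← lintegral_add_right _ (by fun_prop),
        ← lintegral_add_left (by fun_prop), ← lintegral_const_mul _ (by fun_prop)]
      refine lintegral_mono_ae ?_
      filter_upwards [hae g hg, hae h hh] with x hgx hhx using hc _ _ hgx hhx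
    have hImid : I N ≤ ∫⁻ x, ((g x + h x) / 2) ^ q ∂μ := iInf₂_le _ (hmid N g hg.1 h hh.1)
    have hcI : (c : ℝ≥0∞) * I N ≠ ∞ :=
      ENNReal.mul_ne_top ENNReal.coe_ne_top ((hIB N).trans_lt ENNReal.coe_lt_top).ne
    refine (ENNReal.add_le_add_iff_right hcI).1 ?_
    have hεη : (ε : ℝ≥0∞) * (((B : ℝ≥0∞) + 1) + (B + 1)) ≤ η / 2 := by
      have : ε * ((B + 1) + (B + 1)) ≤ η / 2 := by
        apply le_of_eq
        have : (B + 1 : ℝ≥0) ≠ 0 := by positivity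
        rw [hε]; field_simp; norm_num
      have h' : ((ε * ((B + 1) + (B + 1)) : ℝ≥0) : ℝ≥0∞) ≤ ((η / 2 : ℝ≥0) : ℝ≥0∞) := by
        exact_mod_cast this
      rw [ENNReal.coe_div two_ne_zero] at h'
      push_cast at h'
      exact h'
    calc ∫⁻ x, (h x - g x) ^ q ∂μ + c * I N
        ≤ (ε + c / 2) * (∫⁻ x, g x ^ q ∂μ + ∫⁻ x, h x ^ q ∂μ) :=
          le_trans (by gcongr) hint
      _ = ε * (∫⁻ x, g x ^ q ∂μ + ∫⁻ x, h x ^ q ∂μ) +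
            c / 2 * (∫⁻ x, g x ^ q ∂μ + ∫⁻ x, h x ^ q ∂μ) := add_mul _ _ _
      _ ≤ ε * (((B : ℝ≥0∞) + 1) + (B + 1)) +
            c / 2 * ((J + ((N : ℝ≥0∞) + 1)⁻¹) + (J + ((N : ℝ≥0∞) + 1)⁻¹)) := by
          gcongr
          · exact hSfin N g hg
          · exact hSfin N h hh
          · exact hg.2
          · exact hh.2
      _ ≤ η / 2 + (c * J + c * ((N : ℝ≥0∞) + 1)⁻¹) := by
          gcongr
          rw [← two_mul, ← mul_assoc, ENNReal.div_mul_cancel two_ne_zero ENNReal.ofNat_ne_top,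
            mul_add]
      _ ≤ η / 2 + ((c * I N + η / 4) + η / 4) := by gcongr
      _ = η + c * I N := by
          have h4 : (η / 4 : ℝ≥0∞) + η / 4 = η / 2 := by
            have h5 : (4 : ℝ≥0∞) = 2 * 2 := by norm_num
            rw [h5, ENNReal.div_eq_inv_mul, ENNReal.mul_inv (by simp) (by simp), mul_assoc,
              ← ENNReal.div_eq_inv_mul, ← ENNReal.div_eq_inv_mul, ENNReal.add_halves]
          rw [add_assoc, h4, add_comm (_ * _), ← add_assoc, ENNReal.add_halves]
  set η : ℕ → ℝ≥0 := fun k => ((2⁻¹) ^ (k + 1)) ^ q * 2⁻¹ ^ (k + 1) with hη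
  choose N hN using fun k => hcauchy (η k) (by positivity)
  -- `n k ≥ k` and `n k, n (k + 1) ≥ N k`
  set n : ℕ → ℕ := fun k => k + ∑ i ∈ Finset.range (k + 1), N i with hn
  choose h hh using fun k => hSne (n k)
  have hNn : ∀ k l, k ≤ l → N k ≤ n l := fun k l hkl => by
    have : N k ≤ ∑ i ∈ Finset.range (l + 1), N i :=
      Finset.single_le_sum (f := N) (fun _ _ => Nat.zero_le _) (Finset.mem_range.2 (by omega))
    simp only [hn]; omega
  have hstep : ∀ k, ∫⁻ x, (h (k + 1) x - h k x) ^ q ∂μ ≤ η k := fun k =>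
    hN k _ (hSanti (hNn k k le_rfl) (hh k)) _ (hSanti (hNn k (k + 1) k.le_succ) (hh (k + 1)))
  have hhm : ∀ k, Measurable (h k) := fun k => hmeas _ _ (hh k).1
  have hdm : ∀ k, Measurable fun x => h (k + 1) x - h k x := fun k => (hhm _).sub (hhm _)
  have hTm : Measurable fun x => ∑' k, (h (k + 1) x - h k x) := Measurable.tsum hdm
  refine ⟨fun x => h 0 x + ∑' k, (h (k + 1) x - h k x), (hhm 0).add hTm, ?_,
    fun m => ⟨h m, hanti ?_ (hh m).1, fun x => ?_⟩⟩
  · have hT : ∫⁻ x, (∑' k, (h (k + 1) x - h k x)) ^ q ∂μ ≤ 1 := by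
      calc ∫⁻ x, (∑' k, (h (k + 1) x - h k x)) ^ q ∂μ
          ≤ ∫⁻ x, ∑' k, (2 ^ (k + 1) * (h (k + 1) x - h k x)) ^ q ∂μ :=
            lintegral_mono fun x => tsum_rpow_le_tsum_two_pow_mul_rpow hq0 _
        _ = ∑' k, (2 ^ (k + 1)) ^ q * ∫⁻ x, (h (k + 1) x - h k x) ^ q ∂μ := by
            rw [lintegral_tsum fun k => (((hdm k).const_mul _).pow_const q).aemeasurable]
            refine tsum_congr fun k => ?_
            simp only [ENNReal.mul_rpow_of_nonneg _ _ hq0.le]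
            rw [lintegral_const_mul _ ((hdm k).pow_const q)]
        _ ≤ ∑' k, 2⁻¹ ^ (k + 1) := by
            refine ENNReal.tsum_le_tsum fun k => ?_
            calc _ ≤ (2 ^ (k + 1)) ^ q * (η k : ℝ≥0∞) := by gcongr; exact hstep k
              _ = _ := by
                  simp only [hη]
                  rw [ENNReal.coe_mul, ENNReal.coe_rpow_of_nonneg _ hq0.le]
                  push_cast
                  rw [← mul_assoc,
                    ← ENNReal.mul_rpow_of_nonneg _ _ hq0.le, ← mul_pow,
                    ENNReal.mul_inv_cancel two_ne_zero ENNReal.ofNat_ne_top, one_pow,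
                    ENNReal.one_rpow, one_mul]
        _ = 1 := by
            simp only [pow_succ]
            rw [ENNReal.tsum_mul_right, ENNReal.tsum_geometric_two, ENNReal.mul_inv_cancel
              two_ne_zero ENNReal.ofNat_ne_top]
    refine ((lintegral_mono fun x =>
      ENNReal.rpow_add_le_mul_rpow_add_rpow _ _ hq.le).trans_lt ?_).ne
    rw [lintegral_const_mul' _ _ (ENNReal.rpow_ne_top_of_nonneg (by linarith) ENNReal.ofNat_ne_top),
      lintegral_add_left ((hhm 0).pow_const q)]
    refine ENNReal.mul_lt_top (ENNReal.rpow_lt_top_of_nonneg (by linarith) ENNReal.ofNat_ne_top)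
      (ENNReal.add_lt_top.2 ⟨(hSfin _ _ (hh 0)).trans_lt (by norm_num), hT.trans_lt (by norm_num)⟩)
  · simp only [hn]; omega
  · have hpart : ∀ m, h m x ≤ h 0 x + ∑ k ∈ Finset.range m, (h (k + 1) x - h k x) := fun m => by
      induction m with
      | zero => simp
      | succ m ih =>
        rw [Finset.sum_range_succ, ← add_assoc]
        exact le_add_tsub.trans (by gcongr)
    exact (hpart m).trans (add_le_add le_rfl (ENNReal.sum_le_tsum _))

/-! ### Families of curves of zero modulus -/

theorem modulus_mono {X : Type*} [MetricSpace X] [MeasurableSpace X] {μ : Measure X} {p : ℝ}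
    {Γ Γ' : Set (Curve X)} (h : Γ ⊆ Γ') : modulus μ p Γ ≤ modulus μ p Γ' :=
  le_iInf₂ fun ρ hρ => le_iInf fun h' =>
    iInf₂_le_of_le ρ hρ (iInf_le_of_le (fun γ hγ => h' γ (h hγ)) le_rfl)

theorem modulus_iUnion_eq_zero {X : Type*} [MetricSpace X] [MeasurableSpace X] {μ : Measure X}
    {p : ℝ} (hp : 0 < p) {ι : Type*} [Countable ι] {Γ : ι → Set (Curve X)}
    (h : ∀ i, modulus μ p (Γ i) = 0) : modulus μ p (⋃ i, Γ i) = 0 := by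
  refine le_antisymm (le_of_forall_gt fun ε hε => ?_) zero_le
  obtain ⟨δ, hδ, hδε⟩ := ENNReal.exists_pos_sum_of_countable' hε.ne' ι
  have hex : ∀ i, ∃ ρ : X → ℝ≥0∞, Measurable ρ ∧ (∀ γ ∈ Γ i, 1 ≤ γ.lineIntegral ρ) ∧
      ∫⁻ x, ρ x ^ p ∂μ < δ i := fun i => by
    have := (h i).trans_lt (hδ i)
    simp only [modulus, iInf_lt_iff] at this
    obtain ⟨ρ, h1, h2, h3⟩ := this
    exact ⟨ρ, h1, h2, h3⟩
  choose ρ hρm hρΓ hρδ using hex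
  refine lt_of_le_of_lt ?_ hδε
  refine iInf₂_le_of_le (fun x => ⨆ i, ρ i x) (Measurable.iSup hρm) (iInf_le_of_le ?_ ?_)
  · intro γ hγ
    obtain ⟨i, hi⟩ := mem_iUnion.1 hγ
    exact (hρΓ i γ hi).trans (lintegral_mono fun s => le_iSup (fun i => ρ i (γ.toFun s)) i)
  · calc ∫⁻ x, (⨆ i, ρ i x) ^ p ∂μ ≤ ∫⁻ x, ∑' i, ρ i x ^ p ∂μ := by
          refine lintegral_mono fun x => ?_
          rw [← ENNReal.le_rpow_inv_iff hp]
          refine iSup_le fun i => ?_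
          rw [ENNReal.le_rpow_inv_iff hp]
          exact ENNReal.le_tsum (f := fun i => ρ i x ^ p) i
      _ = ∑' i, ∫⁻ x, ρ i x ^ p ∂μ :=
          lintegral_tsum fun i => ((hρm i).pow_const p).aemeasurable
      _ ≤ ∑' i, δ i := ENNReal.tsum_le_tsum fun i => (hρδ i).le

theorem modulus_eq_zero_of_lineIntegral_eq_top {X : Type*} [MetricSpace X] [MeasurableSpace X]
    {μ : Measure X} {p : ℝ} (hp : 0 < p) {Γ : Set (Curve X)} {G : X → ℝ≥0∞} (hG : Measurable G)
    (hGp : ∫⁻ x, G x ^ p ∂μ ≠ ∞) (hΓ : ∀ γ ∈ Γ, γ.lineIntegral G = ∞) : modulus μ p Γ = 0 := by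
  have hle : ∀ c : ℝ≥0∞, c ≠ 0 → c ≠ ∞ → modulus μ p Γ ≤ c ^ p * ∫⁻ x, G x ^ p ∂μ :=
      fun c hc hc' => by
    refine iInf₂_le_of_le (fun x => c * G x) (hG.const_mul _) (iInf_le_of_le ?_ ?_)
    · intro γ hγ
      have h1 := hΓ γ hγ
      simp only [Curve.lineIntegral] at h1 ⊢
      rw [lintegral_const_mul' _ _ hc', h1, ENNReal.mul_top hc]
      exact le_top
    · simp only [ENNReal.mul_rpow_of_nonneg _ _ hp.le]
      rw [lintegral_const_mul _ (hG.pow_const p)]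
  have hlim : Tendsto (fun n : ℕ => ((n + 1 : ℕ) : ℝ≥0∞)⁻¹) atTop (𝓝 0) :=
    (tendsto_add_atTop_iff_nat 1).2 ENNReal.tendsto_inv_nat_nhds_zero
  have hlim2 : Tendsto (fun n : ℕ => ((n + 1 : ℕ) : ℝ≥0∞)⁻¹ ^ p) atTop (𝓝 0) := by
    have := hlim.ennrpow_const p
    rwa [ENNReal.zero_rpow_of_pos hp] at this
  have hlim3 := ENNReal.Tendsto.mul_const hlim2 (b := ∫⁻ x, G x ^ p ∂μ) (Or.inr hGp)
  rw [zero_mul] at hlim3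
  refine le_antisymm (ge_of_tendsto' hlim3 fun n => hle _ ?_ ?_) zero_le
  · exact ENNReal.inv_ne_zero.2 (ENNReal.natCast_ne_top _)
  · exact ENNReal.inv_ne_top.2 (by exact_mod_cast n.succ_ne_zero)

/-! ### Hausdorff content and gradients at a given scale -/

/-- The size `δ` approximation of the one-dimensional Hausdorff measure: the infimum of `∑ diam t_n`
over countable covers of `s` by sets of diameter at most `δ`. The form of the definition is that of
`MeasureTheory.Measure.hausdorffMeasure_apply`, so that `H¹` is its supremum over `δ > 0`. -/
def hausdorffContent {Y : Type*} [MetricSpace Y] (δ : ℝ≥0∞) (s : Set Y) : ℝ≥0∞ :=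
  ⨅ (t : ℕ → Set Y) (_ : s ⊆ ⋃ n, t n) (_ : ∀ n, Metric.ediam (t n) ≤ δ),
    ∑' n, ⨆ _ : (t n).Nonempty, Metric.ediam (t n) ^ (1 : ℝ)

theorem hausdorffContent_anti {Y : Type*} [MetricSpace Y] {δ δ' : ℝ≥0∞} (h : δ ≤ δ') (s : Set Y) :
    hausdorffContent δ' s ≤ hausdorffContent δ s :=
  le_iInf₂ fun t ht => le_iInf fun htδ =>
    iInf₂_le_of_le t ht (iInf_le_of_le (fun n => (htδ n).trans h) le_rfl)

theorem hausdorffContent_le_tsum {Y : Type*} [MetricSpace Y] {δ : ℝ≥0∞} {s : Set Y} {ι : Type*}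
    [Countable ι] (t : ι → Set Y) (hst : s ⊆ ⋃ i, t i) (ht : ∀ i, Metric.ediam (t i) ≤ δ) :
    hausdorffContent δ s ≤ ∑' i, Metric.ediam (t i) := by
  have : Encodable ι := Encodable.ofCountable _
  set u : ℕ → Set Y := fun j => ⋃ b ∈ Encodable.decode₂ ι j, t b
  refine iInf₂_le_of_le u (by rwa [Encodable.iUnion_decode₂]) ?_
  refine iInf_le_of_le (fun j => ?_) ?_
  · rw [Metric.ediam_iUnion_mem_option]
    exact iSup₂_le fun _ _ => ht _
  · calc (∑' j : ℕ, ⨆ _ : (u j).Nonempty, Metric.ediam (u j) ^ (1 : ℝ)) = _ :=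
          tsum_iUnion_decode₂ (fun t : Set Y => ⨆ _ : t.Nonempty, Metric.ediam t ^ (1 : ℝ))
            (by simp) _
      _ ≤ _ := ENNReal.tsum_le_tsum fun b => iSup_le fun _ => by rw [ENNReal.rpow_one]

theorem hausdorffMeasure_one_le_of_hausdorffContent_le {Y : Type*} [MetricSpace Y]
    [MeasurableSpace Y] [BorelSpace Y] {s : Set Y} {c : ℝ≥0∞} {δ : ℕ → ℝ≥0∞}
    (hδ : Tendsto δ atTop (𝓝 0)) (h : ∀ᶠ n in atTop, hausdorffContent (δ n) s ≤ c) :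
    Measure.hausdorffMeasure 1 s ≤ c := by
  rw [Measure.hausdorffMeasure_apply]
  refine iSup₂_le fun r hr => ?_
  obtain ⟨n, hn, hnr⟩ := (h.and (hδ.eventually_lt_const hr)).exists
  exact (hausdorffContent_anti hnr.le s).trans hn

/-- `g` is an upper gradient of `f` along `A` at scale `δ`: for each `1`-Lipschitz curve `φ : J → Ω`
on an interval `J` of length at least `δ`, the size `δ` Hausdorff content of `f(φ(J) ∩ A)` is at
most `2 ∫_J g(φ(s)) ds`. All kinds of intervals are allowed, and the curve need not be parametrized by
arc length. In contrast to its limit as `δ → 0`, this condition holds for the functions constructed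
from coverings, and it is stable under midpoints. -/
def IsUpperGradientAtScale {X Y : Type*} [MetricSpace X] [MetricSpace Y] (Ω A : Set X)
    (f : X → Y) (δ : ℝ≥0∞) (g : X → ℝ≥0∞) : Prop :=
  ∀ (φ : ℝ → X) (J : Set ℝ), J.OrdConnected → LipschitzOnWith 1 φ J → φ '' J ⊆ Ω → δ ≤ volume J →
    hausdorffContent δ (f '' (φ '' J ∩ A)) ≤ 2 * ∫⁻ s in J, g (φ s)

theorem aemeasurable_comp_of_lipschitzOnWith {X : Type*} [MetricSpace X] [MeasurableSpace X]
    [BorelSpace X] {φ : ℝ → X} {J : Set ℝ} (hJ : J.OrdConnected) {K : ℝ≥0}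
    (hφ : LipschitzOnWith K φ J)
    {g : X → ℝ≥0∞} (hg : Measurable g) :
    AEMeasurable (fun s => g (φ s)) (volume.restrict J) :=
  hg.comp_aemeasurable (hφ.continuousOn.aemeasurable hJ.measurableSet)

section

variable {X Y : Type*} [MetricSpace X] [MetricSpace Y] {Ω A : Set X} {f : X → Y}

theorem IsUpperGradientAtScale.anti {δ δ' : ℝ≥0∞} (h : δ ≤ δ') {g : X → ℝ≥0∞}
    (hg : IsUpperGradientAtScale Ω A f δ g) : IsUpperGradientAtScale Ω A f δ' g :=
  fun φ J hJ hφ hΩ hδ => (hausdorffContent_anti h _).trans (hg φ J hJ hφ hΩ (h.trans hδ))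

theorem IsUpperGradientAtScale.mono {δ : ℝ≥0∞} {g g' : X → ℝ≥0∞} (h : ∀ x, g x ≤ g' x)
    (hg : IsUpperGradientAtScale Ω A f δ g) : IsUpperGradientAtScale Ω A f δ g' :=
  fun φ J hJ hφ hΩ hδ => (hg φ J hJ hφ hΩ hδ).trans (by gcongr; exact h _)

theorem Curve.lipschitzOnWith (γ : Curve X) : LipschitzOnWith 1 γ.toFun (Icc 0 γ.len) := by
  intro a ha b hb
  wlog hab : a ≤ b generalizing a b
  · rw [edist_comm, edist_comm a]
    exact this hb ha (le_of_not_ge hab)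
  have h := γ.unitSpeed ha hb
  have h1 := eVariationOn.edist_le γ.toFun (s := Icc 0 γ.len ∩ Icc a b)
    ⟨ha, left_mem_Icc.2 hab⟩ ⟨hb, right_mem_Icc.2 hab⟩
  rw [h] at h1
  refine h1.trans_eq ?_
  rw [edist_comm, edist_dist, Real.dist_eq, abs_of_nonneg (sub_nonneg.2 hab)]
  simp

theorem hausdorffMeasure_image_le_of_isUpperGradientAtScale [MeasurableSpace Y] [BorelSpace Y]
    {δ : ℕ → ℝ≥0∞} (hδ : Tendsto δ atTop (𝓝 0)) {G : X → ℝ≥0∞}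
    (hG : ∀ n, IsUpperGradientAtScale Ω A f (δ n) G) {φ : ℝ → X} {J : Set ℝ}
    (hJ : J.OrdConnected) (hφ : LipschitzOnWith 1 φ J) (hΩ : φ '' J ⊆ Ω) :
    Measure.hausdorffMeasure 1 (f '' (φ '' J ∩ A)) ≤ 2 * ∫⁻ s in J, G (φ s) := by
  -- intervals of length zero are points, to which the hypothesis says nothing
  rcases eq_or_ne (volume J) 0 with h0 | h0
  · have hsub : J.Subsingleton := by
      intro a ha b hb
      by_contra hab
      wlog hlt : a < b generalizing a b
      · exact this hb ha (Ne.symm hab) (lt_of_le_of_ne (not_lt.1 hlt) (Ne.symm hab))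
      have := measure_mono_null (hJ.out ha hb) h0
      rw [Real.volume_Icc, ENNReal.ofReal_eq_zero] at this
      linarith
    have : (f '' (φ '' J ∩ A)).Subsingleton :=
      ((hsub.image φ).anti inter_subset_left).image f
    have := Measure.nullSingletonClass_hausdorff Y one_pos
    rw [Set.Subsingleton.measure_zero ‹_›]
    exact zero_le
  · exact hausdorffMeasure_one_le_of_hausdorffContent_le hδ
      ((hδ.eventually_le_const (pos_iff_ne_zero.2 h0)).mono fun n hn => hG n φ J hJ hφ hΩ hn)

/-- The measure `G(γ(s)) ds` is finite and vanishes on `N`, hence is small on an open set containing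
`N`; the estimate for intervals is then summed over the components of this open set. -/
theorem lusinNOn_of_isUpperGradientAtScale [MeasurableSpace Y] [BorelSpace Y]
    {δ : ℕ → ℝ≥0∞} (hδ : Tendsto δ atTop (𝓝 0)) {G : X → ℝ≥0∞}
    (hG : ∀ n, IsUpperGradientAtScale Ω A f (δ n) G) {γ : Curve X} (hγΩ : γ.image ⊆ Ω)
    (hγG : γ.lineIntegral G ≠ ∞) : LusinNOn A f γ := by
  intro N hN hN0
  set κ : Measure ℝ := (volume.restrict (Icc 0 γ.len)).withDensity fun s => G (γ.toFun s) with hκ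
  have hκfin : IsFiniteMeasure κ := isFiniteMeasure_withDensity hγG
  have hκN : κ N = 0 := withDensity_absolutelyContinuous _ _
    (Measure.absolutelyContinuous_of_le Measure.restrict_le_self hN0)
  have hκI : ∀ I : Set ℝ, MeasurableSet I → κ I = ∫⁻ s in I ∩ Icc 0 γ.len, G (γ.toFun s) :=
    fun I hI => by rw [hκ, withDensity_apply _ hI, Measure.restrict_restrict hI]
  refine le_antisymm (le_of_forall_gt fun ε hε => ?_) zero_le
  obtain ⟨U, hNU, hU, hUε⟩ := N.exists_isOpen_lt_of_lt (μ := κ) (ε / 2)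
    (by rw [hκN]; exact ENNReal.half_pos hε.ne')
  -- the components of `U` are disjoint open intervals
  set 𝒞 : Set (Set ℝ) := (fun x => connectedComponentIn U x) '' U with h𝒞
  have h𝒞o : ∀ I ∈ 𝒞, IsOpen I := by
    rintro _ ⟨x, -, rfl⟩; exact hU.connectedComponentIn
  have h𝒞ne : ∀ I ∈ 𝒞, I.Nonempty := by
    rintro _ ⟨x, hx, rfl⟩; exact ⟨x, mem_connectedComponentIn hx⟩
  have h𝒞oc : ∀ I ∈ 𝒞, I.OrdConnected := by
    rintro _ ⟨x, -, rfl⟩; exact isPreconnected_connectedComponentIn.ordConnected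
  have h𝒞d : 𝒞.PairwiseDisjoint id := by
    rintro _ ⟨x, hx, rfl⟩ _ ⟨y, hy, rfl⟩ hne
    refine disjoint_left.2 fun z hzx hzy => hne ?_
    exact (connectedComponentIn_eq hzx).trans (connectedComponentIn_eq hzy).symm
  have h𝒞U : ⋃ I ∈ 𝒞, I = U := by
    refine Subset.antisymm (iUnion₂_subset ?_) fun x hx =>
      mem_biUnion (mem_image_of_mem _ hx) (mem_connectedComponentIn hx)
    rintro _ ⟨x, -, rfl⟩; exact connectedComponentIn_subset _ _
  have h𝒞c : 𝒞.Countable := h𝒞d.countable_of_isOpen h𝒞o h𝒞ne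
  have hcov : f '' (γ.toFun '' N ∩ A) ⊆
      ⋃ I ∈ 𝒞, f '' (γ.toFun '' (I ∩ Icc 0 γ.len) ∩ A) := by
    rintro _ ⟨_, ⟨⟨s, hs, rfl⟩, hsA⟩, rfl⟩
    have hsU := hNU hs
    rw [← h𝒞U] at hsU
    obtain ⟨I, hI, hsI⟩ := mem_iUnion₂.1 hsU
    exact mem_biUnion hI ⟨_, ⟨⟨s, ⟨hsI, hN hs⟩, rfl⟩, hsA⟩, rfl⟩
  calc Measure.hausdorffMeasure 1 (f '' (γ.toFun '' N ∩ A))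
      ≤ ∑' I : 𝒞, Measure.hausdorffMeasure 1 (f '' (γ.toFun '' ((I : Set ℝ) ∩ Icc 0 γ.len) ∩ A)) :=
        (measure_mono hcov).trans (measure_biUnion_le _ h𝒞c _)
    _ ≤ ∑' I : 𝒞, 2 * κ I := by
        refine ENNReal.tsum_le_tsum fun I => ?_
        rw [hκI _ (h𝒞o I I.2).measurableSet]
        exact hausdorffMeasure_image_le_of_isUpperGradientAtScale hδ hG
          ((h𝒞oc I I.2).inter ordConnected_Icc) (γ.lipschitzOnWith.mono inter_subset_right)
          ((image_mono inter_subset_right).trans hγΩ)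
    _ = 2 * κ U := by
        have h := measure_biUnion (μ := κ) h𝒞c h𝒞d fun I hI => (h𝒞o I hI).measurableSet
        simp only [id, h𝒞U] at h
        rw [ENNReal.tsum_mul_left, ← h]
    _ < ε := by
        rw [mul_comm]
        exact (ENNReal.lt_div_iff_mul_lt (by simp) (by simp)).1 hUε

variable [MeasurableSpace X] [BorelSpace X]

theorem IsUpperGradientAtScale.midpoint {δ : ℝ≥0∞} {g h : X → ℝ≥0∞} (hgm : Measurable g)
    (hg : IsUpperGradientAtScale Ω A f δ g)
    (hh : IsUpperGradientAtScale Ω A f δ h) :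
    IsUpperGradientAtScale Ω A f δ fun x => (g x + h x) / 2 := fun φ J hJ hφ hΩ hδ => by
  have h1 := hg φ J hJ hφ hΩ hδ
  have h2 := hh φ J hJ hφ hΩ hδ
  simp only [div_eq_mul_inv]
  rw [lintegral_mul_const' _ _ (by simp),
    lintegral_add_left' (aemeasurable_comp_of_lipschitzOnWith hJ hφ hgm)]
  set c := hausdorffContent δ (f '' (φ '' J ∩ A))
  calc c = (c + c) * 2⁻¹ := by
        rw [← div_eq_mul_inv, ENNReal.add_div, ENNReal.add_halves]
    _ ≤ (2 * (∫⁻ s in J, g (φ s)) + 2 * ∫⁻ s in J, h (φ s)) * 2⁻¹ :=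
        mul_le_mul_left (add_le_add h1 h2) _
    _ = _ := by rw [← mul_add, mul_assoc]

end

/-! ### Selection of covering balls -/

/-- Greedy selection along a well-founded relation: `x` is selected unless some `y` selected before
it satisfies `R y x`. -/
theorem exists_greedy {α : Type*} {lt : α → α → Prop} (wf : WellFounded lt) (R : α → α → Prop) :
    ∃ S : Set α, ∀ x, x ∈ S ↔ ∀ y ∈ S, lt y x → ¬ R y x := by
  refine ⟨{x | wf.fix (C := fun _ => Prop) (fun x ih => ∀ y (h : lt y x), ih y h → ¬ R y x) x},
    fun x => ?_⟩
  rw [mem_ofPred_eq, wf.fix_eq]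
  exact ⟨fun h y hy hlt => h y hlt hy, fun h y hlt hy => h y hy hlt⟩

/-- Covering lemma without enlargement: the balls `B(y, r y)`, `y ∈ S`, cover `A`. Points are
selected in order of decreasing dyadic size of the radius, each lying outside the balls selected
before. Two selected points are therefore at least as far apart as the larger radius, unless the
radii are comparable, in which case half of the larger radius is still a bound. -/
theorem exists_subset_ball_cover {X : Type*} [MetricSpace X] {A : Set X} {r : X → ℝ}
    (hr : ∀ x ∈ A, 0 < r x) (hr1 : ∀ x ∈ A, r x ≤ 1) :
    ∃ S ⊆ A, (∀ x ∈ A, ∃ y ∈ S, x ∈ Metric.ball y (r y)) ∧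
      ∀ x ∈ S, ∀ y ∈ S, x ≠ y → max (r x) (r y) ≤ dist x y ∨
        (r x < 2 * r y ∧ r y < 2 * r x ∧ max (r x) (r y) / 2 < dist x y) := by
  have hlev : ∀ x : A, ∃ n : ℕ, (1 / 2 : ℝ) ^ (n + 1) < r x ∧ r x ≤ (1 / 2 : ℝ) ^ n := fun x =>
    exists_nat_pow_near_of_lt_one (hr x x.2) (hr1 x x.2) (by norm_num) (by norm_num)
  choose k hk1 hk2 using hlev
  -- a well-order of `A` refining the order by dyadic level
  set lt : A → A → Prop := InvImage (Prod.Lex (· < ·) WellOrderingRel) fun x => (k x, x) with hlt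
  have hwf : WellFounded lt := InvImage.wf _ (WellFounded.prod_lex wellFounded_lt
    WellOrderingRel.isWellOrder.wf)
  obtain ⟨S, hS⟩ := exists_greedy hwf fun y x : A => (x : X) ∈ Metric.ball (y : X) (r y)
  have key : ∀ x ∈ S, ∀ y ∈ S, lt y x → max (r x) (r y) ≤ dist (x : X) y ∨
        (r x < 2 * r y ∧ r y < 2 * r x ∧ max (r x) (r y) / 2 < dist (x : X) y) := by
    intro x hx y hy hyx
    have hd : r y ≤ dist (x : X) y := not_lt.1 ((hS x).1 hx y hy hyx)
    rcases (Prod.lex_def.1 hyx) with h | ⟨h, -⟩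
    · have h' : k y < k x := h
      left
      have : r x ≤ r y := (hk2 x).trans
        ((pow_le_pow_of_le_one (by norm_num) (by norm_num) h').trans (hk1 y).le)
      exact max_le (this.trans hd) hd
    · have h' : k y = k x := h
      right
      have h1 := hk1 x; have h2 := hk2 x; have h3 := hk1 y; have h4 := hk2 y
      rw [h'] at h3 h4
      rw [pow_succ] at h1 h3
      refine ⟨by linarith, by linarith, ?_⟩
      rcases le_total (r (x : X)) (r (y : X)) with hle | hle
      · rw [max_eq_right hle]; linarith
      · rw [max_eq_left hle]; linarith
  have htri : ∀ x y : A, x ≠ y → lt x y ∨ lt y x := by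
    intro x y hxy
    rcases lt_trichotomy (k x) (k y) with h | h | h
    · exact Or.inl (Prod.Lex.left _ _ h)
    · rcases trichotomous_of WellOrderingRel x y with h' | h' | h'
      · exact Or.inl (Prod.lex_def.2 (Or.inr ⟨h, h'⟩))
      · exact absurd h' hxy
      · exact Or.inr (Prod.lex_def.2 (Or.inr ⟨h.symm, h'⟩))
    · exact Or.inr (Prod.Lex.left _ _ h)
  refine ⟨(↑) '' S, by simp, fun x hx => ?_, ?_⟩
  · by_cases hxS : (⟨x, hx⟩ : A) ∈ S
    · exact ⟨x, ⟨_, hxS, rfl⟩, Metric.mem_ball_self (hr x hx)⟩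
    · rw [hS] at hxS
      push Not at hxS
      obtain ⟨y, hy, -, hxy⟩ := hxS
      exact ⟨y, ⟨y, hy, rfl⟩, hxy⟩
  · rintro _ ⟨x, hx, rfl⟩ _ ⟨y, hy, rfl⟩ hne
    rcases htri x y (fun h => hne (congrArg _ h)) with h | h
    · have := key y hy x hx h
      rw [max_comm, dist_comm]
      tauto
    · exact key x hx y hy h

/-! ### Doubling measures -/

/-- The doubling condition of `μ` with constant `C` for balls centred at `x` with radius at most
`R`, including that these balls have positive and finite measure. -/
def DoublingAt {X : Type*} [MetricSpace X] [MeasurableSpace X] (μ : Measure X) (C : ℝ≥0)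
    (R : ℝ) (x : X) : Prop :=
  ∀ r : ℝ, 0 < r → r ≤ R → 0 < μ (Metric.ball x r) ∧ μ (Metric.ball x r) < ∞ ∧
    μ (Metric.ball x (2 * r)) ≤ C * μ (Metric.ball x r)

theorem DoublingAt.pow {X : Type*} [MetricSpace X] [MeasurableSpace X] {μ : Measure X} {C : ℝ≥0}
    {R : ℝ} {x : X} (h : DoublingAt μ C R x) {r : ℝ} (hr : 0 < r) (n : ℕ) (hn : 2 ^ n * r ≤ R) :
    μ (Metric.ball x (2 ^ n * r)) ≤ C ^ n * μ (Metric.ball x r) := by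
  induction n with
  | zero => simp
  | succ n ih =>
    have h0 : 0 < 2 ^ n * r := by positivity
    have h1 : 2 ^ n * r ≤ R := le_trans (by rw [pow_succ]; linarith) hn
    have h2 : (2 : ℝ) ^ (n + 1) * r = 2 * (2 ^ n * r) := by ring
    rw [h2]
    calc _ ≤ C * μ (Metric.ball x (2 ^ n * r)) := (h _ h0 h1).2.2
      _ ≤ C * (C ^ n * μ (Metric.ball x r)) := by gcongr; exact ih h1
      _ = _ := by ring

/-- Bounded overlap: balls of comparable radii containing a common point `w`, with centres separated
by a multiple of the radii, are boundedly many. -/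
theorem card_le_of_doublingAt {X : Type*} [MetricSpace X] [MeasurableSpace X] [BorelSpace X]
    {μ : Measure X} {C : ℝ≥0} {R : ℝ} (T : Finset X) (hT : ∀ x ∈ T, DoublingAt μ C R x)
    {r : X → ℝ} (hr : ∀ x ∈ T, 0 < r x) (hrR : ∀ x ∈ T, 16 * r x ≤ R) {w : X}
    (hw : ∀ x ∈ T, dist w x < r x)
    (hsep : ∀ x ∈ T, ∀ y ∈ T, x ≠ y →
      r x < 2 * r y ∧ r y < 2 * r x ∧ max (r x) (r y) / 2 < dist x y) :
    (T.card : ℝ≥0∞) ≤ C ^ 7 := by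
  rcases T.eq_empty_or_nonempty with rfl | ⟨x₀, hx₀⟩
  · simp
  have hr₀ := hr x₀ hx₀
  have hR₀ := hrR x₀ hx₀
  have hcomp : ∀ x ∈ T, r x < 2 * r x₀ ∧ r x₀ < 2 * r x := fun x hx => by
    rcases eq_or_ne x x₀ with rfl | h
    · constructor <;> linarith
    · exact ⟨(hsep x hx x₀ hx₀ h).1, (hsep x hx x₀ hx₀ h).2.1⟩
  have hnear : ∀ x ∈ T, dist x x₀ < 3 * r x₀ := fun x hx => by
    have h1 := hw x hx
    have h2 := hw x₀ hx₀
    have h3 := dist_triangle_left x x₀ w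
    linarith [(hcomp x hx).1]
  set big := Metric.ball x₀ (4 * r x₀) with hbig
  obtain ⟨hpos, hfin, -⟩ := hT x₀ hx₀ (4 * r x₀) (by linarith) (by linarith)
  have hsmall : ∀ x ∈ T, μ big ≤ C ^ 7 * μ (Metric.ball x (r x₀ / 8)) := fun x hx => by
    refine (measure_mono ?_).trans ((hT x hx).pow (r := r x₀ / 8) (by linarith) 7 (by linarith))
    intro z hz
    have h1 := Metric.mem_ball.1 hz
    have h2 := dist_triangle_right z x x₀
    rw [Metric.mem_ball]
    linarith [hnear x hx]
  have hdisj : (T : Set X).PairwiseDisjoint fun x => Metric.ball x (r x₀ / 8) := by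
    intro x hx y hy hne
    refine Metric.ball_disjoint_ball ?_
    have h1 := (hsep x hx y hy hne).2.2
    have h2 := (hcomp x hx).2
    have h3 := le_max_left (r x) (r y)
    linarith
  have hsum : ∑ x ∈ T, μ (Metric.ball x (r x₀ / 8)) ≤ μ big := by
    rw [← measure_biUnion_finset hdisj fun x _ => Metric.isOpen_ball.measurableSet]
    refine measure_mono (iUnion₂_subset fun x hx z hz => ?_)
    have h1 := Metric.mem_ball.1 hz
    have h2 := dist_triangle z x x₀
    rw [hbig, Metric.mem_ball]
    linarith [hnear x hx]
  have : (T.card : ℝ≥0∞) * μ big ≤ C ^ 7 * μ big := by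
    calc (T.card : ℝ≥0∞) * μ big = ∑ x ∈ T, μ big := by rw [Finset.sum_const, nsmul_eq_mul]
      _ ≤ ∑ x ∈ T, C ^ 7 * μ (Metric.ball x (r x₀ / 8)) := Finset.sum_le_sum hsmall
      _ = C ^ 7 * ∑ x ∈ T, μ (Metric.ball x (r x₀ / 8)) := by rw [Finset.mul_sum]
      _ ≤ _ := by gcongr
  exact (ENNReal.mul_le_mul_iff_left hpos.ne' hfin.ne).1 this

/-! ### Gradients built from coverings by balls -/

/-- An interval of length at least `r` spends length at least `r` within distance `r` of any of its
points. -/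
theorem ofReal_le_volume_inter_closedBall {J : Set ℝ} (hJ : J.OrdConnected) {s r : ℝ} (hs : s ∈ J)
    (hr : 0 ≤ r) (hrJ : ENNReal.ofReal r ≤ volume J) :
    ENNReal.ofReal r ≤ volume (J ∩ Metric.closedBall s r) := by
  rw [Real.closedBall_eq_Icc]
  by_cases h : J ⊆ Icc (s - r) (s + r)
  · rwa [inter_eq_left.2 h]
  · obtain ⟨t, htJ, ht⟩ := not_subset.1 h
    rcases lt_or_ge t (s - r) with hlt | hge
    · calc ENNReal.ofReal r = volume (Icc (s - r) s) := by rw [Real.volume_Icc]; ring_nf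
        _ ≤ _ := measure_mono fun u (hu : u ∈ Icc (s - r) s) =>
          show u ∈ J ∩ Icc (s - r) (s + r) from
          ⟨hJ.out htJ hs ⟨hlt.le.trans hu.1, hu.2⟩, hu.1, by linarith [hu.2]⟩
    · have hgt : s + r < t := by
        by_contra! h'
        exact ht ⟨hge, h'⟩
      calc ENNReal.ofReal r = volume (Icc s (s + r)) := by rw [Real.volume_Icc]; ring_nf
        _ ≤ _ := measure_mono fun u (hu : u ∈ Icc s (s + r)) =>
          show u ∈ J ∩ Icc (s - r) (s + r) from
          ⟨hJ.out hs htJ ⟨hu.1, hu.2.trans hgt.le⟩, by linarith [hu.1], hu.2⟩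

/-- Passage to countable families in `lintegral_sum_indicator_closedBall_rpow_le`. -/
theorem lintegral_tsum_indicator_closedBall_rpow_le {X : Type*} [PseudoMetricSpace X]
    [MeasurableSpace X] [BorelSpace X] {μ : Measure X} {ι : Type*} [Countable ι]
    {x : ι → X} {r : ι → ℝ} {K : ℝ≥0} (hr : ∀ i, 0 < r i)
    (hK : ∀ i, μ (Metric.closedBall (x i) (8 * r i)) ≤ K * μ (Metric.ball (x i) (r i / 4)))
    (hpos : ∀ i, μ (Metric.ball (x i) (r i / 4)) ≠ 0)
    (hfin : ∀ i, μ (Metric.ball (x i) (r i / 4)) ≠ ∞)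
    (hdisj : Pairwise (Function.onFun Disjoint fun i => Metric.ball (x i) (r i / 4)))
    {a : ι → ℝ≥0∞} (ha : ∀ i, a i ≠ ∞) {q : ℝ} (hq : 1 < q) {B : ℝ≥0∞}
    (hB : ∀ s : Finset ι, ∑ i ∈ s, a i ^ q * μ (Metric.ball (x i) (r i / 4)) ≤ B) :
    ∫⁻ z, (∑' i, (Metric.closedBall (x i) (2 * r i)).indicator (fun _ => a i) z) ^ q ∂μ ≤
      (ENNReal.ofReal q * K ^ 2) ^ q * B := by
  have hq0 : 0 < q := zero_lt_one.trans hq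
  have hsup : ∀ z, (∑' i, (Metric.closedBall (x i) (2 * r i)).indicator (fun _ => a i) z) ^ q =
      ⨆ s : Finset ι,
        (∑ i ∈ s, (Metric.closedBall (x i) (2 * r i)).indicator (fun _ => a i) z) ^ q := fun z => by
    rw [ENNReal.tsum_eq_iSup_sum]
    exact (ENNReal.orderIsoRpow q hq0).map_iSup _
  simp_rw [hsup]
  rw [lintegral_iSup_directed]
  · exact iSup_le fun s => (lintegral_sum_indicator_closedBall_rpow_le s (fun i _ => hr i)
      (fun i _ => hK i) (fun i _ => hpos i) (fun i _ => hfin i) (hdisj.set_pairwise _)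
      (fun i _ => ha i) hq).trans (by gcongr; exact hB s)
  · intro s
    refine Measurable.aemeasurable (Measurable.pow_const ?_ q)
    exact Finset.measurable_fun_sum _ fun i _ =>
      measurable_const.indicator Metric.isClosed_closedBall.measurableSet
  · refine Monotone.directed_le fun s t hst z => ENNReal.rpow_le_rpow ?_ hq0.le
    exact Finset.sum_le_sum_of_subset hst

/-- A curve of length at least `r i` that meets `B(x i, r i)` spends length at least `r i` in
`B(x i, 2 * r i)`, so it picks up at least `L_f(x i, r i)`, which is half the bound for the diameter
of `f(B(x i, r i))`. -/
theorem isUpperGradientAtScale_tsum_indicator {X Y : Type*} [MetricSpace X] [MeasurableSpace X]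
    [BorelSpace X] [MetricSpace Y] {Ω A : Set X} {f : X → Y} {ι : Type*} [Countable ι]
    {x : ι → X} {r : ι → ℝ} (hr : ∀ i, 0 < r i) (hcov : A ⊆ ⋃ i, Metric.ball (x i) (r i))
    {δ : ℝ≥0∞} (hrδ : ∀ i, ENNReal.ofReal (r i) ≤ δ)
    (hLδ : ∀ i, 2 * Lsup Ω f (x i) (r i) ≤ δ) :
    IsUpperGradientAtScale Ω A f δ fun z => ∑' i, (Metric.closedBall (x i) (2 * r i)).indicator
      (fun _ => Lsup Ω f (x i) (r i) / ENNReal.ofReal (r i)) z := by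
  classical
  intro φ J hJ hφ hΩ hδ
  have hVm : ∀ i, MeasurableSet (Metric.closedBall (x i) (2 * r i)) :=
    fun i => Metric.isClosed_closedBall.measurableSet
  set t : ι → Set Y := fun i => if (φ '' J ∩ Metric.ball (x i) (r i)).Nonempty then
    f '' (Metric.ball (x i) (r i) ∩ Ω) else ∅ with ht
  have htd : ∀ i, Metric.ediam (t i) ≤ 2 * Lsup Ω f (x i) (r i) := fun i => by
    simp only [ht]
    split_ifs
    · refine Metric.ediam_image_le_iff.2 fun y hy z hz => ?_
      have hL : ∀ y ∈ Metric.ball (x i) (r i) ∩ Ω, edist (f y) (f (x i)) ≤ Lsup Ω f (x i) (r i) :=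
        fun y hy => le_iSup₂_of_le (f := fun y _ => edist (f y) (f (x i))) y
          ⟨hy.2, (Metric.mem_ball.1 hy.1).le⟩ le_rfl
      rw [two_mul]
      exact (edist_triangle_right _ _ (f (x i))).trans (add_le_add (hL y hy) (hL z hz))
    · simp
  have hst : f '' (φ '' J ∩ A) ⊆ ⋃ i, t i := by
    rintro _ ⟨y, ⟨hyJ, hyA⟩, rfl⟩
    obtain ⟨i, hi⟩ := mem_iUnion.1 (hcov hyA)
    refine mem_iUnion.2 ⟨i, ?_⟩
    simp only [ht]
    rw [if_pos ⟨y, hyJ, hi⟩]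
    exact mem_image_of_mem f ⟨hi, hΩ hyJ⟩
  rw [lintegral_tsum fun i => aemeasurable_comp_of_lipschitzOnWith hJ hφ
    (measurable_const.indicator (hVm i)), ← ENNReal.tsum_mul_left]
  refine (hausdorffContent_le_tsum t hst fun i => (htd i).trans (hLδ i)).trans
    (ENNReal.tsum_le_tsum fun i => ?_)
  by_cases hhit : (φ '' J ∩ Metric.ball (x i) (r i)).Nonempty
  · refine (htd i).trans (mul_le_mul_right ?_ _)
    obtain ⟨_, ⟨s, hs, rfl⟩, hsi⟩ := hhit
    have h0 : ENNReal.ofReal (r i) ≠ 0 := by simpa using hr i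
    calc Lsup Ω f (x i) (r i)
        = Lsup Ω f (x i) (r i) / ENNReal.ofReal (r i) * ENNReal.ofReal (r i) :=
          (ENNReal.div_mul_cancel h0 ENNReal.ofReal_ne_top).symm
      _ ≤ Lsup Ω f (x i) (r i) / ENNReal.ofReal (r i) *
            volume (J ∩ Metric.closedBall s (r i)) := by
          gcongr
          exact ofReal_le_volume_inter_closedBall hJ hs (hr i).le ((hrδ i).trans hδ)
      _ = ∫⁻ _ in J ∩ Metric.closedBall s (r i),
            Lsup Ω f (x i) (r i) / ENNReal.ofReal (r i) := by rw [setLIntegral_const]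
      _ ≤ ∫⁻ u in J ∩ Metric.closedBall s (r i), (Metric.closedBall (x i) (2 * r i)).indicator
            (fun _ => Lsup Ω f (x i) (r i) / ENNReal.ofReal (r i)) (φ u) := by
          refine setLIntegral_mono' (hJ.measurableSet.inter
            Metric.isClosed_closedBall.measurableSet) fun u hu => ?_
          have h1 : dist (φ u) (φ s) ≤ dist u s := by simpa using hφ.dist_le_mul u hu.1 s hs
          have h2 := Metric.mem_closedBall.1 hu.2
          have h3 := Metric.mem_ball.1 hsi
          have h4 := dist_triangle (φ u) (φ s) (x i)
          rw [indicator_of_mem (Metric.mem_closedBall.2 (by linarith))]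
      _ ≤ _ := lintegral_mono_set inter_subset_left
  · simp only [ht, if_neg hhit, Metric.ediam_empty, zero_le]

/-! ### Energy estimate from the distortion -/

section

variable {X Y : Type*} [MetricSpace X] [MetricSpace Y] {Ω A : Set X} {f : X → Y}

theorem eventually_Lsup_le (hfc : ContinuousOn f Ω) {x : X} (hx : x ∈ Ω) {η : ℝ≥0∞} (hη : 0 < η) :
    ∀ᶠ r in 𝓝[>] (0 : ℝ), Lsup Ω f x r ≤ η := by
  have h := (hfc x hx).eventually (Metric.eball_mem_nhds (f x) hη)
  obtain ⟨ε, hε, hsub⟩ := Metric.mem_nhdsWithin_iff.1 h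
  filter_upwards [Ioo_mem_nhdsGT hε] with r hr
  refine iSup₂_le fun y hy => (le_of_lt ?_)
  exact hsub ⟨hy.2.trans_lt hr.2, hy.1⟩

theorem Lsup_le_mul_edist {x : X} {r M : ℝ} (hM : 0 < M)
    (h : distortionAt Ω f x r ≤ ENNReal.ofReal M) {y : X} (hy : y ∈ Ω) (hr : r ≤ dist y x) :
    Lsup Ω f x r ≤ ENNReal.ofReal M * edist (f y) (f x) := by
  have hM0 : ENNReal.ofReal M ≠ 0 := by simpa using hM
  have hl : linf Ω f x r ≤ edist (f y) (f x) := iInf₂_le (f := fun y _ => edist (f y) (f x)) y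
    ⟨hy, hr⟩
  rw [distortionAt] at h
  split_ifs at h with h0
  · exact absurd h (by simp)
  · rw [ENNReal.div_le_iff_le_mul (Or.inl h0) (Or.inr hM0)] at h
    exact h.trans (by gcongr)

/-- The image balls `B(f x, ρ x)` of a selected family overlap boundedly. By `hρ`, two of them can
only meet if the distance of the centres is less than the larger radius, so that the radii are
comparable, and a point `f w` of `B(f x, ρ x)` has `w ∈ B(x, r x)`. Hence `card_le_of_doublingAt`
applies to the balls whose images contain a given point. -/
theorem sum_measure_ball_image_le [MeasurableSpace X] [BorelSpace X] [MeasurableSpace Y]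
    [BorelSpace Y] {μ : Measure X} (ν : Measure Y)
    {C : ℝ≥0} {R : ℝ} (F : Finset X) (hF : ∀ x ∈ F, DoublingAt μ C R x)
    (hFΩ : ∀ x ∈ F, x ∈ Ω) (hfΩ : MeasurableSet (f '' Ω))
    {r ρ : X → ℝ} (hr : ∀ x ∈ F, 0 < r x) (hrR : ∀ x ∈ F, 16 * r x ≤ R)
    (hsep : ∀ x ∈ F, ∀ y ∈ F, x ≠ y → max (r x) (r y) ≤ dist x y ∨
      (r x < 2 * r y ∧ r y < 2 * r x ∧ max (r x) (r y) / 2 < dist x y))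
    (hρΩ : ∀ x ∈ F, Metric.ball (f x) (ρ x) ⊆ f '' Ω)
    (hρ : ∀ x ∈ F, ∀ y ∈ Ω, r x ≤ dist y x → 2 * ρ x ≤ dist (f y) (f x)) :
    ∑ x ∈ F, ν (Metric.ball (f x) (ρ x)) ≤ C ^ 7 * ν (f '' Ω) := by
  classical
  have hm : ∀ x, MeasurableSet (Metric.ball (f x) (ρ x)) := fun x =>
    Metric.isOpen_ball.measurableSet
  calc ∑ x ∈ F, ν (Metric.ball (f x) (ρ x))
      = ∑ x ∈ F, ∫⁻ z, (Metric.ball (f x) (ρ x)).indicator 1 z ∂ν :=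
        Finset.sum_congr rfl fun x _ => (lintegral_indicator_one (hm x)).symm
    _ = ∫⁻ z, ∑ x ∈ F, (Metric.ball (f x) (ρ x)).indicator 1 z ∂ν :=
        (lintegral_finsetSum _ fun x _ => measurable_one.indicator (hm x)).symm
    _ ≤ ∫⁻ z, (f '' Ω).indicator (fun _ => (C : ℝ≥0∞) ^ 7) z ∂ν := by
        refine lintegral_mono fun z => ?_
        set T := F.filter fun x => z ∈ Metric.ball (f x) (ρ x) with hT
        have hcard : ∑ x ∈ F, (Metric.ball (f x) (ρ x)).indicator (1 : Y → ℝ≥0∞) z = T.card := by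
          simp only [indicator_apply, Pi.one_apply]
          rw [Finset.sum_boole]
        rw [hcard]
        by_cases hz : z ∈ f '' Ω
        · rw [indicator_of_mem hz]
          obtain ⟨w, hw, rfl⟩ := hz
          have hTF : ∀ x ∈ T, x ∈ F ∧ dist (f w) (f x) < ρ x := fun x hx => by
            simpa [hT] using hx
          refine card_le_of_doublingAt T (fun x hx => hF x (hTF x hx).1)
            (fun x hx => hr x (hTF x hx).1) (fun x hx => hrR x (hTF x hx).1) (w := w) ?_ ?_
          · intro x hx
            by_contra! h
            have h1 := hρ x (hTF x hx).1 w hw h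
            have h2 := (hTF x hx).2
            have h3 := dist_nonneg (x := f w) (y := f x)
            linarith
          · intro x hx y hy hne
            refine (hsep x (hTF x hx).1 y (hTF y hy).1 hne).resolve_left fun h => ?_
            have h1 := hρ x (hTF x hx).1 y (hFΩ y (hTF y hy).1)
              (by rw [dist_comm]; exact (le_max_left _ _).trans h)
            have h2 := hρ y (hTF y hy).1 x (hFΩ x (hTF x hx).1) ((le_max_right _ _).trans h)
            have h3 := (hTF x hx).2
            have h4 := (hTF y hy).2
            have h5 := dist_triangle_left (f x) (f y) (f w)
            rw [dist_comm] at h1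
            linarith
        · rw [indicator_of_notMem hz]
          have : T = ∅ := Finset.filter_eq_empty_iff.2 fun x hx hzx => hz (hρΩ x hx hzx)
          simp [this]
    _ = _ := lintegral_indicator_const hfΩ _

/-- The contribution of one ball to the energy; `l` stands for `L_f(x, r)`. As the exponent `q` may
be smaller than `Q`, the estimate `a ^ q ≤ 1 + a ^ Q` causes the first term on the right. -/
theorem rpow_mul_measure_ball_le [MeasurableSpace X] [MeasurableSpace Y] {μ : Measure X}
    {ν : Measure Y} {x : X} {r l M q Q : ℝ} (hr : 0 < r) (hl0 : 0 ≤ l) (hl1 : l ≤ 1) (hM : 1 ≤ M)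
    (hq : 0 ≤ q) (hqQ : q ≤ Q) (hQ : 0 < Q) (hQM : Q ≤ M)
    (hvol : μ (Metric.ball x r) ≤ ENNReal.ofReal M * ENNReal.ofReal (r ^ Q))
    (hν : ∀ s, 0 < s → s < 1 / M →
      ENNReal.ofReal (s ^ Q) ≤ ENNReal.ofReal M * ν (Metric.ball (f x) s)) :
    (ENNReal.ofReal l / ENNReal.ofReal r) ^ q * μ (Metric.ball x (r / 4)) ≤
      μ (Metric.ball x (r / 4)) +
        ENNReal.ofReal (M * (2 * M) ^ M * M) * ν (Metric.ball (f x) (l / (2 * M))) := by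
  have hM0 : 0 < M := by linarith
  rw [← ENNReal.ofReal_div_of_pos hr]
  set a := ENNReal.ofReal (l / r) with ha
  have hle : a ^ q ≤ 1 + a ^ Q := by
    rcases le_total a 1 with h | h
    · exact (ENNReal.rpow_le_one h hq).trans le_self_add
    · exact (ENNReal.rpow_le_rpow_of_exponent_le h hqQ).trans le_add_self
  have hmain : a ^ Q * μ (Metric.ball x r) ≤
      ENNReal.ofReal (M * (2 * M) ^ M * M) * ν (Metric.ball (f x) (l / (2 * M))) := by
    rcases eq_or_lt_of_le hl0 with rfl | hl
    · simp [ha, hQ]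
    have hs : l / (2 * M) < 1 / M := by
      rw [div_lt_div_iff₀ (by positivity) hM0]; nlinarith
    have hlQ : l ^ Q = (2 * M) ^ Q * (l / (2 * M)) ^ Q := by
      rw [← Real.mul_rpow (by positivity) (by positivity)]
      congr 1
      field_simp
    calc a ^ Q * μ (Metric.ball x r)
        ≤ ENNReal.ofReal ((l / r) ^ Q) * (ENNReal.ofReal M * ENNReal.ofReal (r ^ Q)) := by
          rw [ha, ENNReal.ofReal_rpow_of_nonneg (by positivity) hQ.le]
          gcongr
      _ = ENNReal.ofReal (M * l ^ Q) := by
          rw [← ENNReal.ofReal_mul hM0.le, ← ENNReal.ofReal_mul (by positivity),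
            Real.div_rpow hl0 hr.le]
          congr 1
          field_simp
      _ ≤ ENNReal.ofReal (M * (2 * M) ^ M * (l / (2 * M)) ^ Q) := by
          rw [hlQ, ← mul_assoc]
          gcongr
          linarith
      _ = ENNReal.ofReal (M * (2 * M) ^ M) * ENNReal.ofReal ((l / (2 * M)) ^ Q) :=
          ENNReal.ofReal_mul (by positivity)
      _ ≤ ENNReal.ofReal (M * (2 * M) ^ M) *
            (ENNReal.ofReal M * ν (Metric.ball (f x) (l / (2 * M)))) := by
          gcongr
          exact hν _ (by positivity) hs
      _ = _ := by rw [← mul_assoc, ← ENNReal.ofReal_mul (by positivity)]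
  calc a ^ q * μ (Metric.ball x (r / 4)) ≤ (1 + a ^ Q) * μ (Metric.ball x (r / 4)) := by gcongr
    _ = μ (Metric.ball x (r / 4)) + a ^ Q * μ (Metric.ball x (r / 4)) := by
        rw [add_mul, one_mul]
    _ ≤ μ (Metric.ball x (r / 4)) + a ^ Q * μ (Metric.ball x r) := by
        gcongr
        linarith
    _ ≤ _ := by gcongr

/-- On a piece `A` with uniform constants there are upper gradients at every scale with a common
bound of their `L^q` norms. -/
theorem exists_isUpperGradientAtScale_lintegral_le [MeasurableSpace X] [BorelSpace X]
    [MeasurableSpace Y] [BorelSpace Y] {μ : Measure X} {ν : Measure Y}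
    (hfc : ContinuousOn f Ω) (hfΩ : IsOpen (f '' Ω)) (hνΩ : ν (f '' Ω) ≠ ∞) (hAΩ : A ⊆ Ω)
    {C : ℝ≥0} {R : ℝ} (hR : 0 < R) (hdb : ∀ x ∈ Ω, DoublingAt μ C R x) {U : Set X}
    (hU : ∀ x ∈ Ω, Metric.ball x R ⊆ U) (hUfin : μ U ≠ ∞)
    {M : ℝ} (hM : 1 ≤ M) {Q : X → ℝ} {q : ℝ} (hq : 1 < q) (hqQ : ∀ x ∈ A, q ≤ Q x)
    (hQM : ∀ x ∈ A, Q x ≤ M)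
    (hvol : ∀ x ∈ A, ∀ r, 0 < r → r < 1 / M →
      μ (Metric.ball x r) ≤ ENNReal.ofReal M * ENNReal.ofReal (r ^ Q x))
    (hν : ∀ x ∈ A, ∀ r, 0 < r → r < 1 / M →
      ENNReal.ofReal (r ^ Q x) ≤ ENNReal.ofReal M * ν (Metric.ball (f x) r))
    (hdist : ∀ x ∈ A, ∃ᶠ r in 𝓝[>] (0 : ℝ), distortionAt Ω f x r ≤ ENNReal.ofReal M) :
    ∃ B : ℝ≥0, ∀ δ : ℝ≥0∞, 0 < δ → ∃ g : X → ℝ≥0∞, Measurable g ∧ ∫⁻ x, g x ^ q ∂μ ≤ B ∧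
      IsUpperGradientAtScale Ω A f δ g := by
  have hM0 : 0 < M := by linarith
  set B : ℝ≥0∞ := (ENNReal.ofReal q * ((C ^ 6 : ℝ≥0) : ℝ≥0∞) ^ 2) ^ q *
    (μ U + ENNReal.ofReal (M * (2 * M) ^ M * M) * (C ^ 7 * ν (f '' Ω))) with hB
  have hBfin : B ≠ ∞ := by
    refine ENNReal.mul_ne_top (ENNReal.rpow_ne_top_of_nonneg (by linarith)
      (ENNReal.mul_ne_top ENNReal.ofReal_ne_top (ENNReal.pow_ne_top ENNReal.coe_ne_top)))
      (ENNReal.add_ne_top.2 ⟨hUfin, ENNReal.mul_ne_top ENNReal.ofReal_ne_top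
        (ENNReal.mul_ne_top (ENNReal.pow_ne_top ENNReal.coe_ne_top) hνΩ)⟩)
  refine ⟨B.toNNReal, fun δ hδ => ?_⟩
  rw [ENNReal.coe_toNNReal hBfin]
  -- good radii
  have hrad : ∀ x ∈ A, ∃ r : ℝ, 0 < r ∧ r ≤ 1 ∧ r < 1 / M ∧ 16 * r ≤ R ∧ ENNReal.ofReal r ≤ δ ∧
      Lsup Ω f x r ≤ 1 ∧ 2 * Lsup Ω f x r ≤ δ ∧
      Metric.ball (f x) ((Lsup Ω f x r).toReal / (2 * M)) ⊆ f '' Ω ∧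
      distortionAt Ω f x r ≤ ENNReal.ofReal M := fun x hx => by
    obtain ⟨ε, hε, hεΩ⟩ := Metric.isOpen_iff.1 hfΩ (f x) (mem_image_of_mem f (hAΩ hx))
    have hrδ : ∀ᶠ r in 𝓝[>] (0 : ℝ), ENNReal.ofReal r ≤ δ := by
      have : Tendsto ENNReal.ofReal (𝓝[>] 0) (𝓝 0) := by
        have := (ENNReal.continuous_ofReal.tendsto 0).mono_left
          (nhdsWithin_le_nhds (s := Ioi (0 : ℝ)))
        rwa [ENNReal.ofReal_zero] at this
      exact this.eventually_le_const hδ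
    have hev : ∀ᶠ r in 𝓝[>] (0 : ℝ), (0 < r ∧ r < min (min 1 (1 / M)) (R / 16)) ∧
        ENNReal.ofReal r ≤ δ ∧ Lsup Ω f x r ≤ 1 ∧ Lsup Ω f x r ≤ δ / 2 ∧
        Lsup Ω f x r ≤ ENNReal.ofReal ε :=
      Filter.Eventually.and (Ioo_mem_nhdsGT (by positivity)) <| hrδ.and <|
        (eventually_Lsup_le hfc (hAΩ hx) one_pos).and <|
        (eventually_Lsup_le hfc (hAΩ hx) (ENNReal.half_pos hδ.ne')).and
        (eventually_Lsup_le hfc (hAΩ hx) (ENNReal.ofReal_pos.2 hε))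
    obtain ⟨r, hrM, ⟨hr0, hr⟩, hrδ, hL1, hLδ, hLε⟩ := ((hdist x hx).and_eventually hev).exists
    simp only [lt_min_iff] at hr
    refine ⟨r, hr0, hr.1.1.le, hr.1.2, by linarith [hr.2], hrδ, hL1, ?_, ?_, hrM⟩
    · rw [mul_comm]
      exact (ENNReal.le_div_iff_mul_le (by simp) (by simp)).1 hLδ
    · refine (Metric.ball_subset_ball ?_).trans hεΩ
      have h1 : (Lsup Ω f x r).toReal ≤ ε := ENNReal.toReal_le_of_le_ofReal hε.le hLε
      refine (div_le_self ENNReal.toReal_nonneg (by linarith)).trans h1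
  choose! r hr0 hr1 hrM hrR hrδ hL1 hLδ hLΩ hdis using hrad
  obtain ⟨S, hSA, hcov, hsep⟩ := exists_subset_ball_cover hr0 hr1
  have hS0 : ∀ x : S, 0 < r x := fun x => hr0 x (hSA x.2)
  have hSdb : ∀ x : S, DoublingAt μ C R x := fun x => hdb x (hAΩ (hSA x.2))
  have hSR : ∀ x : S, 16 * r x ≤ R := fun x => hrR x (hSA x.2)
  have hcore : ∀ x : S, 0 < μ (Metric.ball (x : X) (r x / 4)) ∧
      μ (Metric.ball (x : X) (r x / 4)) < ∞ := fun x => by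
    have h := hSdb x (r x / 4) (by linarith [hS0 x]) (by linarith [hS0 x, hSR x])
    exact ⟨h.1, h.2.1⟩
  have hdisj : Pairwise (Function.onFun Disjoint fun x : S => Metric.ball (x : X) (r x / 4)) := by
    intro x y hne
    refine Metric.ball_disjoint_ball ?_
    have h1 := le_max_left (r x) (r y)
    have h2 := le_max_right (r x) (r y)
    have h3 := hS0 x
    have h4 := hS0 y
    rcases hsep x x.2 y y.2 (fun h => hne (Subtype.ext h)) with h | ⟨-, -, h⟩ <;> linarith
  have hcoreU : ∀ x : S, Metric.ball (x : X) (r x / 4) ⊆ U := fun x =>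
    (Metric.ball_subset_ball (by linarith [hS0 x, hSR x])).trans (hU x (hAΩ (hSA x.2)))
  -- disjoint sets of positive measure in a set of finite measure
  have hcount : Countable S := by
    have : IsFiniteMeasure (μ.restrict U) := isFiniteMeasure_restrict.2 hUfin
    have h := Measure.countable_meas_pos_of_disjoint_iUnion (μ := μ.restrict U)
      (As := fun x : S => Metric.ball (x : X) (r x / 4))
      (fun x => Metric.isOpen_ball.measurableSet) hdisj
    refine countable_univ_iff.1 (h.mono fun x _ => ?_)
    have : μ.restrict U (Metric.ball (x : X) (r x / 4)) = μ (Metric.ball (x : X) (r x / 4)) := by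
      rw [Measure.restrict_apply Metric.isOpen_ball.measurableSet, inter_eq_left.2 (hcoreU x)]
    change 0 < μ.restrict U (Metric.ball (x : X) (r x / 4))
    rw [this]
    exact (hcore x).1
  have hLfin : ∀ x : S, Lsup Ω f x (r x) ≠ ∞ := fun x =>
    ((hL1 x (hSA x.2)).trans_lt ENNReal.one_lt_top).ne
  refine ⟨fun z => ∑' x : S, (Metric.closedBall (x : X) (2 * r x)).indicator
      (fun _ => Lsup Ω f x (r x) / ENNReal.ofReal (r x)) z, ?_, ?_, ?_⟩
  · exact Measurable.tsum fun x =>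
      measurable_const.indicator Metric.isClosed_closedBall.measurableSet
  · refine lintegral_tsum_indicator_closedBall_rpow_le (K := C ^ 6) hS0 (fun x => ?_)
      (fun x => (hcore x).1.ne') (fun x => (hcore x).2.ne) hdisj
      (fun x => ENNReal.div_ne_top (hLfin x) (by simpa using hS0 x)) hq fun s => ?_
    · have h := (hSdb x).pow (r := r x / 4) (by linarith [hS0 x]) 6 (by linarith [hSR x])
      rw [ENNReal.coe_pow]
      refine (measure_mono (Metric.closedBall_subset_ball ?_)).trans h
      linarith [hS0 x]
    · have hterm : ∀ x : S, (Lsup Ω f x (r x) / ENNReal.ofReal (r x)) ^ q *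
          μ (Metric.ball (x : X) (r x / 4)) ≤ μ (Metric.ball (x : X) (r x / 4)) +
          ENNReal.ofReal (M * (2 * M) ^ M * M) *
            ν (Metric.ball (f x) ((Lsup Ω f x (r x)).toReal / (2 * M))) := fun x => by
        have h := rpow_mul_measure_ball_le (f := f) (hS0 x) ENNReal.toReal_nonneg
          (ENNReal.toReal_le_of_le_ofReal zero_le_one (by simpa using hL1 x (hSA x.2))) hM
          (by linarith) (hqQ x (hSA x.2)) (by linarith [hqQ x (hSA x.2)]) (hQM x (hSA x.2))
          (hvol x (hSA x.2) _ (hS0 x) (hrM x (hSA x.2))) (hν x (hSA x.2))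
          (l := (Lsup Ω f x (r x)).toReal)
        rwa [ENNReal.ofReal_toReal (hLfin x)] at h
      have hsum := sum_measure_ball_image_le (μ := μ) ν (Ω := Ω) (f := f) (C := C) (R := R)
        (s.map (Function.Embedding.subtype (· ∈ S))) (r := r)
        (ρ := fun x => (Lsup Ω f x (r x)).toReal / (2 * M))
        (by simpa using fun x hx _ => hSdb ⟨x, hx⟩) (by simpa using fun x hx _ => hAΩ (hSA hx))
        hfΩ.measurableSet (by simpa using fun x hx _ => hS0 ⟨x, hx⟩)
        (by simpa using fun x hx _ => hSR ⟨x, hx⟩)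
        (fun x hx y hy => hsep x (by simp at hx; exact hx.1) y (by simp at hy; exact hy.1))
        (by simpa using fun x hx _ => hLΩ x (hSA hx)) ?_
      · rw [Finset.sum_map] at hsum
        simp only [Function.Embedding.subtype_apply] at hsum
        calc _ ≤ _ := Finset.sum_le_sum fun x _ => hterm x
          _ = ∑ x ∈ s, μ (Metric.ball (x : X) (r x / 4)) +
              ENNReal.ofReal (M * (2 * M) ^ M * M) * ∑ x ∈ s,
                ν (Metric.ball (f x) ((Lsup Ω f x (r x)).toReal / (2 * M))) := by
              rw [Finset.sum_add_distrib, Finset.mul_sum]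
          _ ≤ _ := by
              refine add_le_add ?_ (mul_le_mul_right hsum _)
              rw [← measure_biUnion_finset (hdisj.set_pairwise _)
                fun x _ => Metric.isOpen_ball.measurableSet]
              exact measure_mono (iUnion₂_subset fun x _ => hcoreU x)
      · intro x hx y hy hxy
        have hxS : x ∈ S := by simp at hx; exact hx.1
        have h := Lsup_le_mul_edist hM0 (hdis x (hSA hxS)) hy hxy
        have h' := ENNReal.toReal_mono
          (ENNReal.mul_ne_top ENNReal.ofReal_ne_top (edist_ne_top _ _)) h
        rw [ENNReal.toReal_mul, ENNReal.toReal_ofReal hM0.le, edist_dist,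
          ENNReal.toReal_ofReal dist_nonneg] at h'
        have : 2 * ((Lsup Ω f x (r x)).toReal / (2 * M)) = (Lsup Ω f x (r x)).toReal / M := by
          field_simp
        rw [this, div_le_iff₀ hM0]
        linarith
  · refine isUpperGradientAtScale_tsum_indicator hS0 (fun x hx => ?_)
      (fun x => hrδ x (hSA x.2)) (fun x => hLδ x (hSA x.2))
    obtain ⟨y, hy, hxy⟩ := hcov x hx
    exact mem_iUnion.2 ⟨⟨y, hy⟩, hxy⟩

end

/-! ### Decomposition into pieces with uniform constants -/

theorem DoublingWithin.exists_doublingAt {X : Type*} [MetricSpace X] [MeasurableSpace X]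
    {μ : Measure X} {x₀ : X} {r₀ : ℝ} (hr₀ : 0 < r₀)
    (h : DoublingWithin μ (Metric.ball x₀ (2 * r₀))) :
    μ (Metric.ball x₀ (2 * r₀)) ≠ ∞ ∧
      ∃ C : ℝ≥0, ∀ x ∈ Metric.ball x₀ r₀, DoublingAt μ C r₀ x := by
  obtain ⟨C, hC, h⟩ := h
  refine ⟨?_, C, fun x hx r hr hrr => ?_⟩
  · obtain ⟨-, h1, h2⟩ := h x₀ r₀ hr₀ (Metric.ball_subset_ball (by linarith))
    exact (h1.trans_lt h2).ne
  · have hsub : ∀ s ≤ r, Metric.ball x s ⊆ Metric.ball x₀ (2 * r₀) := fun s hs =>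
      Metric.ball_subset_ball' (by linarith [Metric.mem_ball.1 hx])
    obtain ⟨h1, -, -⟩ := h x (r / 2) (by positivity) (hsub _ (by linarith))
    obtain ⟨-, h2, h3⟩ := h x r hr (hsub r le_rfl)
    rw [mul_div_cancel₀ _ (two_ne_zero' ℝ)] at h1
    refine ⟨h1, lt_of_le_of_lt ?_ h3, h2⟩
    exact le_mul_of_one_le_left' (by exact_mod_cast hC)

theorem exists_lineIntegral_lusinNOn {X Y : Type*} [MetricSpace X] [MeasurableSpace X]
    [BorelSpace X] [MetricSpace Y] [MeasurableSpace Y] [BorelSpace Y] {μ : Measure X}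
    {Ω A : Set X} {f : X → Y} {q : ℝ} (hq : 1 < q) {B : ℝ≥0}
    (hB : ∀ δ : ℝ≥0∞, 0 < δ → ∃ g : X → ℝ≥0∞, Measurable g ∧ ∫⁻ x, g x ^ q ∂μ ≤ B ∧
      IsUpperGradientAtScale Ω A f δ g) :
    ∃ G : X → ℝ≥0∞, Measurable G ∧ ∫⁻ x, G x ^ q ∂μ ≠ ∞ ∧
      ∀ γ : Curve X, γ.image ⊆ Ω → γ.lineIntegral G ≠ ∞ → LusinNOn A f γ := by
  set δ : ℕ → ℝ≥0∞ := fun n => ((n + 1 : ℕ) : ℝ≥0∞)⁻¹ with hδ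
  have hδ0 : Tendsto δ atTop (𝓝 0) :=
    (tendsto_add_atTop_iff_nat 1).2 ENNReal.tendsto_inv_nat_nhds_zero
  have hδpos : ∀ n, 0 < δ n := fun n => ENNReal.inv_pos.2 (ENNReal.natCast_ne_top _)
  have hδanti : Antitone δ := fun m n hmn => ENNReal.inv_le_inv.2 (by exact_mod_cast by omega)
  obtain ⟨G, hGm, hGq, hG⟩ := exists_dominating_of_midpoint_convex (μ := μ) hq
    (C := fun n => {g | Measurable g ∧ IsUpperGradientAtScale Ω A f (δ n) g})
    (fun n g hg => hg.1) (fun m n hmn g hg => ⟨hg.1, hg.2.anti (hδanti hmn)⟩)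
    (fun n g hg h hh => ⟨(hg.1.add hh.1).div_const 2, hg.2.midpoint hg.1 hh.2⟩) (B := B)
    (fun n => by
      obtain ⟨g, h1, h2, h3⟩ := hB (δ n) (hδpos n)
      exact ⟨g, ⟨h1, h3⟩, h2⟩)
  refine ⟨G, hGm, hGq, fun γ hγΩ hγG => lusinNOn_of_isUpperGradientAtScale hδ0 (fun n => ?_)
    hγΩ hγG⟩
  obtain ⟨h, hh, hle⟩ := hG n
  exact hh.2.mono hle

/-- On a set of finite measure `L^q ⊆ L^p` for `p ≤ q`, by `t ^ p ≤ 1 + t ^ q`. -/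
theorem modulus_lineIntegral_eq_top_eq_zero {X : Type*} [MetricSpace X] [MeasurableSpace X]
    {μ : Measure X} {Ω : Set X} (hΩ : MeasurableSet Ω) (hμΩ : μ Ω ≠ ∞) {p q : ℝ} (hp : 0 < p)
    (hpq : p ≤ q) {G : X → ℝ≥0∞} (hG : Measurable G) (hGq : ∫⁻ x, G x ^ q ∂μ ≠ ∞) :
    modulus μ p {γ | γ.image ⊆ Ω ∧ γ.lineIntegral G = ∞} = 0 := by
  refine modulus_eq_zero_of_lineIntegral_eq_top hp (hG.indicator hΩ) ?_ fun γ hγ => ?_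
  · refine (lt_of_le_of_lt ?_ (ENNReal.add_lt_top.2 ⟨hμΩ.lt_top, hGq.lt_top⟩)).ne
    calc ∫⁻ x, Ω.indicator G x ^ p ∂μ ≤ ∫⁻ x, Ω.indicator 1 x + G x ^ q ∂μ := by
          refine lintegral_mono fun x => ?_
          by_cases hx : x ∈ Ω
          · simp only [indicator_of_mem hx, Pi.one_apply]
            rcases le_total (G x) 1 with h | h
            · exact (ENNReal.rpow_le_one h hp.le).trans le_self_add
            · exact (ENNReal.rpow_le_rpow_of_exponent_le h hpq).trans le_add_self
          · simp [indicator_of_notMem hx, hp]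
      _ = _ := by rw [lintegral_add_left (measurable_one.indicator hΩ), lintegral_indicator_one hΩ]
  · rw [← hγ.2]
    exact setLIntegral_congr_fun measurableSet_Icc fun s hs =>
      indicator_of_mem (hγ.1 (mem_image_of_mem _ hs)) G

/-- The infimum of the exponents as a real number; over the empty set, where it is `⊤`, any large
number serves. -/
theorem exists_real_exponent {α : Type*} {s : Set α} {Q : α → ℝ}
    (hQ : 1 < ⨅ x ∈ s, (Q x : EReal)) {p : ℝ} (hpQ : (p : EReal) ≤ ⨅ x ∈ s, (Q x : EReal)) :
    ∃ q : ℝ, 1 < q ∧ p ≤ q ∧ ∀ x ∈ s, q ≤ Q x := by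
  rcases s.eq_empty_or_nonempty with rfl | ⟨x, hx⟩
  · exact ⟨max p 2, lt_of_lt_of_le one_lt_two (le_max_right _ _), le_max_left _ _, by simp⟩
  · have hle : ∀ y ∈ s, ⨅ x ∈ s, (Q x : EReal) ≤ Q y := fun y hy => iInf₂_le y hy
    have htop : ⨅ x ∈ s, (Q x : EReal) ≠ ⊤ := ((hle x hx).trans_lt (EReal.coe_lt_top _)).ne
    have hbot : ⨅ x ∈ s, (Q x : EReal) ≠ ⊥ := (bot_le.trans_lt hQ).ne'
    generalize (⨅ x ∈ s, (Q x : EReal)) = I at *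
    lift I to ℝ using ⟨htop, hbot⟩
    exact ⟨I, by exact_mod_cast hQ, by exact_mod_cast hpQ, fun y hy => by exact_mod_cast hle y hy⟩

/-- The points at which the exponent, the upper volume bound for `μ`, the lower volume bound for `ν`
and the distortion along some sequence of radii are all controlled by the constant `M`, the volume
bounds for radii below `1 / M`. -/
def controlledSet {X Y : Type*} [MetricSpace X] [MeasurableSpace X] [MetricSpace Y]
    [MeasurableSpace Y] (μ : Measure X) (ν : Measure Y) (Ω : Set X) (f : X → Y) (Q : X → ℝ)
    (M : ℝ) : Set X :=
  {x | Q x ≤ M ∧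
    (∀ r, 0 < r → r < 1 / M →
      μ (Metric.ball x r) ≤ ENNReal.ofReal M * ENNReal.ofReal (r ^ Q x)) ∧
    (∀ r, 0 < r → r < 1 / M →
      ENNReal.ofReal (r ^ Q x) ≤ ENNReal.ofReal M * ν (Metric.ball (f x) r)) ∧
    ∃ᶠ r in 𝓝[>] (0 : ℝ), distortionAt Ω f x r ≤ ENNReal.ofReal M}

theorem exists_mem_controlledSet {X Y : Type*} [MetricSpace X] [MeasurableSpace X] [MetricSpace Y]
    [MeasurableSpace Y] {μ : Measure X} {ν : Measure Y} {Ω : Set X} {f : X → Y} {Q : X → ℝ} {x : X}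
    (hlimsup : limsup (fun r : ℝ => μ (Metric.ball x r) / ENNReal.ofReal (r ^ Q x)) (𝓝[>] 0) < ∞)
    (hliminf : 0 <
      liminf (fun r : ℝ => ν (Metric.ball (f x) r) / ENNReal.ofReal (r ^ Q x)) (𝓝[>] 0))
    (hh : distortion Ω f x < ∞) :
    ∃ n : ℕ, x ∈ controlledSet μ ν Ω f Q (n + 1) := by
  obtain ⟨a, ha, -⟩ := ENNReal.lt_iff_exists_nnreal_btwn.1 hlimsup
  obtain ⟨b, hb0, hb⟩ := ENNReal.lt_iff_exists_nnreal_btwn.1 hliminf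
  obtain ⟨c, hc, -⟩ := ENNReal.lt_iff_exists_nnreal_btwn.1 hh
  have hb0 : 0 < b := by exact_mod_cast hb0
  have hfreq : ∃ᶠ r in 𝓝[>] (0 : ℝ), distortionAt Ω f x r < c := frequently_lt_of_liminf_lt
    (by isBoundedDefault) hc
  obtain ⟨ε, hε, hsub⟩ := mem_nhdsGT_iff_exists_Ioo_subset.1
    ((eventually_lt_of_limsup_lt ha).and (eventually_lt_of_lt_liminf hb))
  have hε : 0 < ε := hε
  obtain ⟨n, hn⟩ := exists_nat_ge (max (max (Q x) a) (max (max (1 / b) c) (1 / ε)))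
  simp only [max_le_iff] at hn
  obtain ⟨⟨hQn, han⟩, ⟨hbn, hcn⟩, hεn⟩ := hn
  have hn0 : (0 : ℝ) < n + 1 := by positivity
  have hrε : ∀ r : ℝ, r < 1 / ((n : ℝ) + 1) → r < ε := fun r hr => by
    refine hr.trans_le ?_
    rw [div_le_iff₀ hn0]
    rw [div_le_iff₀ hε] at hεn
    nlinarith
  have hcoe : ∀ (t : ℝ≥0), (t : ℝ) ≤ n → (t : ℝ≥0∞) ≤ ENNReal.ofReal (n + 1) := fun t ht => by
    rw [← ENNReal.ofReal_coe_nnreal]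
    exact ENNReal.ofReal_le_ofReal (by linarith)
  refine ⟨n, by linarith, fun r hr hrn => ?_, fun r hr hrn => ?_, ?_⟩
  · have h0 : ENNReal.ofReal (r ^ Q x) ≠ 0 := by simpa using Real.rpow_pos_of_pos hr _
    have h := (hsub ⟨hr, hrε r hrn⟩).1.le
    rw [ENNReal.div_le_iff h0 ENNReal.ofReal_ne_top] at h
    exact h.trans (by gcongr; exact hcoe a han)
  · have h0 : ENNReal.ofReal (r ^ Q x) ≠ 0 := by simpa using Real.rpow_pos_of_pos hr _
    have h := (hsub ⟨hr, hrε r hrn⟩).2.le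
    rw [ENNReal.le_div_iff_mul_le (Or.inl h0) (Or.inl ENNReal.ofReal_ne_top)] at h
    have hb' : (b : ℝ≥0∞) ≠ 0 := by exact_mod_cast hb0.ne'
    calc ENNReal.ofReal (r ^ Q x) = (b : ℝ≥0∞)⁻¹ * (b * ENNReal.ofReal (r ^ Q x)) := by
          rw [← mul_assoc, ENNReal.inv_mul_cancel hb' ENNReal.coe_ne_top, one_mul]
      _ ≤ ENNReal.ofReal (n + 1) * ν (Metric.ball (f x) r) := by
          gcongr
          rw [← ENNReal.coe_inv hb0.ne']
          refine hcoe _ ?_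
          rw [NNReal.coe_inv, ← one_div]
          exact hbn
  · exact hfreq.mono fun r hr => hr.le.trans (hcoe c hcn)

end MetricQC

end

theorem proposition5p2
    {X Y : Type*} [MetricSpace X] [MeasurableSpace X] [BorelSpace X]
    [ConnectedSpace X] [Nontrivial X]
    [MetricSpace Y] [MeasurableSpace Y] [BorelSpace Y] [TopologicalSpace.SeparableSpace Y]
    (μ : Measure X) (hμ : ∀ (x : X) (r : ℝ), μ (Metric.ball x r) < ∞)
    (ν : Measure Y) (hν : ∀ (y : Y) (r : ℝ), ν (Metric.ball y r) < ∞)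
    (Ω : Set X) (hΩne : Ω.Nonempty) (hΩo : IsOpen Ω) (hΩb : Bornology.IsBounded Ω)
    (f : X → Y) (hf : IsEmbedding (Ω.domRestrict f)) (hfΩo : IsOpen (f '' Ω))
    (hfΩfin : ν (f '' Ω) < ∞)
    (μt : Measure X) (hμt : μ ≤ μt)
    (x₀ : X) (r₀ : ℝ) (hr₀ : 0 < r₀)
    (hdoubling : MetricQC.DoublingWithin μt (Metric.ball x₀ (2 * r₀)))
    (hΩB : Ω ⊆ Metric.ball x₀ r₀)
    (E : Set X) (hE : E ⊆ Ω)
    (Q : X → ℝ) (hQ : ∀ x ∈ Ω \ E, 1 < Q x)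
    (hlimsup : ∀ x ∈ Ω \ E,
      limsup (fun r : ℝ => μt (Metric.ball x r) / ENNReal.ofReal (r ^ Q x)) (𝓝[>] 0) < ∞)
    (hliminf : ∀ x ∈ Ω \ E,
      0 < liminf (fun r : ℝ => ν (Metric.ball (f x) r) / ENNReal.ofReal (r ^ Q x)) (𝓝[>] 0))
    (hQinf : 1 < ⨅ x ∈ Ω \ E, (Q x : EReal))
    (p : ℝ) (hp : 1 ≤ p) (hpQ : (p : EReal) ≤ ⨅ x ∈ Ω \ E, (Q x : EReal))
    (hEmod : MetricQC.modulus μ p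
      {γ : MetricQC.Curve X | γ.image ⊆ Ω ∧
        0 < Measure.hausdorffMeasure 1 (f '' (γ.image ∩ E))} = 0)
    (hh : ∀ x ∈ Ω \ E, MetricQC.distortion Ω f x < ∞) :
    MetricQC.AECurveIn μ p Ω (fun γ => MetricQC.LusinN f γ) := by
  obtain ⟨q, hq1, hpq, hqQ⟩ := MetricQC.exists_real_exponent hQinf hpQ
  obtain ⟨hUfin, C, hC⟩ := hdoubling.exists_doublingAt hr₀
  have hfc : ContinuousOn f Ω := continuousOn_iff_continuous_domRestrict.2 hf.continuous
  set A : ℕ → Set X := fun n => Ω \ E ∩ MetricQC.controlledSet μt ν Ω f Q (n + 1) with hA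
  have hcover : Ω ⊆ E ∪ ⋃ n, A n := fun x hx => by
    by_cases hxE : x ∈ E
    · exact Or.inl hxE
    · have hx' : x ∈ Ω \ E := ⟨hx, hxE⟩
      obtain ⟨n, hn⟩ := MetricQC.exists_mem_controlledSet (hlimsup x hx') (hliminf x hx') (hh x hx')
      exact Or.inr (mem_iUnion.2 ⟨n, hx', hn⟩)
  have hG : ∀ n, ∃ G : X → ℝ≥0∞, Measurable G ∧ ∫⁻ x, G x ^ q ∂μt ≠ ∞ ∧
      ∀ γ : MetricQC.Curve X, γ.image ⊆ Ω → γ.lineIntegral G ≠ ∞ → MetricQC.LusinNOn (A n) f γ := by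
    intro n
    obtain ⟨B, hB⟩ := MetricQC.exists_isUpperGradientAtScale_lintegral_le (A := A n) (ν := ν)
      (M := n + 1) hfc hfΩo hfΩfin.ne (fun x hx => hx.1.1) hr₀ (fun x hx => hC x (hΩB hx))
      (U := Metric.ball x₀ (2 * r₀))
      (fun x hx => Metric.ball_subset_ball' (by linarith [Metric.mem_ball.1 (hΩB hx)]))
      hUfin (by simp) hq1 (fun x hx => hqQ x hx.1) (fun x hx => hx.2.1) (fun x hx => hx.2.2.1)
      (fun x hx => hx.2.2.2.1) (fun x hx => hx.2.2.2.2)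
    exact MetricQC.exists_lineIntegral_lusinNOn hq1 hB
  choose G hGm hGq hGN using hG
  have hμΩ : μ Ω ≠ ∞ := ((measure_mono hΩB).trans_lt (hμ x₀ r₀)).ne
  set Γ : Option ℕ → Set (MetricQC.Curve X) := fun o => o.elim
    {γ | γ.image ⊆ Ω ∧ 0 < Measure.hausdorffMeasure 1 (f '' (γ.image ∩ E))}
    fun n => {γ | γ.image ⊆ Ω ∧ γ.lineIntegral (G n) = ∞} with hΓ
  have hΓ0 : ∀ o, MetricQC.modulus μ p (Γ o) = 0 := by
    rintro (_ | n)
    · exact hEmod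
    · exact MetricQC.modulus_lineIntegral_eq_top_eq_zero hΩo.measurableSet hμΩ (by linarith) hpq
        (hGm n) ((lintegral_mono' hμt le_rfl).trans_lt (hGq n).lt_top).ne
  refine le_antisymm ((MetricQC.modulus_mono ?_).trans_eq
    (MetricQC.modulus_iUnion_eq_zero (by linarith) hΓ0)) zero_le
  rintro γ ⟨hγΩ, hγN⟩
  by_contra hγ
  simp only [mem_iUnion, not_exists] at hγ
  refine hγN fun N hN hN0 => ?_
  have hEnull : Measure.hausdorffMeasure 1 (f '' (γ.image ∩ E)) = 0 := by
    by_contra h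
    exact hγ none ⟨hγΩ, pos_iff_ne_zero.2 h⟩
  have hAnull : ∀ n, Measure.hausdorffMeasure 1 (f '' (γ.toFun '' N ∩ A n)) = 0 := fun n =>
    hGN n γ hγΩ (fun h => hγ (some n) ⟨hγΩ, h⟩) N hN hN0
  refine measure_mono_null (t := f '' (γ.image ∩ E) ∪ ⋃ n, f '' (γ.toFun '' N ∩ A n)) ?_
    (measure_union_null hEnull (measure_iUnion_null hAnull))
  rintro _ ⟨_, ⟨⟨s, hs, rfl⟩, -⟩, rfl⟩
  have hsγ : γ.toFun s ∈ γ.image := mem_image_of_mem _ (hN hs)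
  rcases hcover (hγΩ hsγ) with h | h
  · exact Or.inl (mem_image_of_mem f ⟨hsγ, h⟩)
  · obtain ⟨n, hn⟩ := mem_iUnion.1 h
    exact Or.inr (mem_iUnion.2 ⟨n, mem_image_of_mem f ⟨mem_image_of_mem _ hs, hn⟩⟩)
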